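/- Let $\Gamma$ be a finite connected simple graph with vertex set $X$, path-length distance $\partial$ and diameter $D\ge 1$, and assume that $\Gamma$ is distance-regular: for $0\le h,i,j\le D$ the number of $z\in X$ with $\partial(x,z)=i$ and $\partial(y,z)=j$ is the same for all $x,y\in X$ with $\partial(x,y)=h$. For $0\le i\le D$ let $A_i\in \mathrm{Mat}_X(\mathbb C)$ be the $i$-th distance-matrix, with $(x,y)$-entry $1$ if $\partial(x,y)=i$ and $0$ otherwise, and let $M=\mathrm{Span}\{A_0,\dots,A_D\}$ be the Bose-Mesner algebra. Let $\{E_i\}_{i=0}^D$ be an ordering of the primitive idempotents of $\Gamma$ that starts with the trivial one: a basis of $M$ such that $E_0=|X|^{-1}J$ (where $J$ is the all-ones matrix), $E_iE_j=\delta_{i,j}E_i$ and $\sum_{i=0}^D E_i=I$. Define $P,Q\in\mathrm{Mat}_{D+1}(\mathbb C)$ and the Krein parameters $q^h_{ij}$ by $$A_j=\sum_{i=0}^D P_{ij}E_i,\qquad E_j=|X|^{-1}\sum_{i=0}^D Q_{ij}A_i,\qquad E_i\circ E_j=|X|^{-1}\sum_{h=0}^D q^h_{ij}E_h,$$ where $\circ$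 is the entrywise product, and put $\theta_i=P_{i1}$, $\theta^*_i=Q_{i1}$ $(0\le i\le D)$. The graph $\Gamma$ is called $Q$-polynomial with respect to $\{E_i\}_{i=0}^D$ if for $0\le h,i,j\le D$ the scalar $q^h_{ij}$ is zero (resp. nonzero) whenever one of $h,i,j$ is greater than (resp. equal to) the sum of the other two. Fix $x\in X$. For $0\le i\le D$ let $E^*_i$ be the diagonal matrix with $(y,y)$-entry $1$ if $\partial(x,y)=i$ and $0$ otherwise, and let $A^*_1$ be the diagonal matrix with $(y,y)$-entry $|X|\,(E_1)_{x,y}$. Let $T$ be the subalgebra of $\mathrm{Mat}_X(\mathbb C)$ generated by $M$ and $E^*_0,\dots,E^*_D$. The primary $T$-module is $U=M\hat x\subseteq\mathbb C^X$, where $\hat x$ is the characteristic vector of $x$. Let $V$ be a vector space of dimension $d+1$ over a field. A Leonard system on $V$ is a sequence $\Phi=(A;\{F_i\}_{i=0}^d;A^*;\{F^*_i\}_{i=0}^d)$ in $\mathrm{End}(V)$ such that: - there is a basis of $V$ with respect to which $A$ is irreducible tridiagonal and $A^*$ is diagonal, and a basis with respect to which $A^*$ is irreducible tridiagonal and $A$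 is diagonal; - $A$ is multiplicity-free (diagonalizable with one-dimensional eigenspaces), $F_0,\dots,F_d$ are the projections onto its eigenspaces in some order, and there is a basis $v_i\in F_iV$ $(0\le i\le d)$ of $V$ with respect to which $A^*$ is irreducible tridiagonal and $A$ is diagonal; - the previous condition holds with $(A,\{F_i\})$ and $(A^*,\{F^*_i\})$ interchanged. Here a square matrix is irreducible tridiagonal if it is tridiagonal and all entries on its subdiagonal and superdiagonal are nonzero. A Leonard system $\Phi$ is self-dual if there is an algebra automorphism of $\mathrm{End}(V)$ that sends $A\mapsto A^*$, $A^*\mapsto A$, $F_i\mapsto F^*_i$ and $F^*_i\mapsto F_i$ for $0\le i\le d$. Then the following are equivalent: 1. $\Gamma$ is formally self-dual with respect to $\{E_i\}_{i=0}^D$, that is, $P=Q$; 2. $\Gamma$ is $Q$-polynomial with respect to $\{E_i\}_{i=0}^D$ and $\theta_i=\theta^*_i$ for $0\le i\le D$; 3. the sequence $(A_1;\{E_i\}_{i=0}^D;A^*_1;\{E^*_i\}_{i=0}^D)$ acts on the primary $T$-module $U$ as a self-dual Leonard system. -/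

import Mathlib

open scoped Matrix

namespace LeonardDRG

/-! ### Leonard pairs and Leonard systems -/

section Leonard

/-- Square tridiagonal matrix, with every entry on the subdiagonal and superdiagonal nonzero. -/
def IsIrreducibleTridiagonal {F : Type*} [Field F] {d : ℕ}
    (M : Matrix (Fin (d + 1)) (Fin (d + 1)) F) : Prop :=
  (∀ i j, M i j ≠ 0 → (i : ℕ) = j ∨ (i : ℕ) = j + 1 ∨ (j : ℕ) = i + 1) ∧
  (∀ i j : Fin (d + 1), (i : ℕ) = j + 1 → M i j ≠ 0) ∧
  (∀ i j : Fin (d + 1), (j : ℕ) = i + 1 → M i j ≠ 0)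

/-- With respect to the basis `b`, the matrix of `A` is irreducible tridiagonal and the matrix of
`B` is diagonal. -/
def IsTridiagonalDiagonal {F V : Type*} [Field F] [AddCommGroup V] [Module F V] {d : ℕ}
    (b : Module.Basis (Fin (d + 1)) F V) (A B : Module.End F V) : Prop :=
  IsIrreducibleTridiagonal (LinearMap.toMatrix b b A) ∧ (LinearMap.toMatrix b b B).IsDiag

/-- `A, A'` is a Leonard pair on `V`, where `dim V = d + 1`. -/
def IsLeonardPair {F V : Type*} [Field F] [AddCommGroup V] [Module F V] (d : ℕ)
    (A A' : Module.End F V) : Prop :=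
  (∃ b : Module.Basis (Fin (d + 1)) F V, IsTridiagonalDiagonal b A A') ∧
  (∃ b : Module.Basis (Fin (d + 1)) F V, IsTridiagonalDiagonal b A' A)

/-- `A` is diagonalizable and each of its eigenspaces has dimension one. -/
def IsMultiplicityFree {F V : Type*} [Field F] [AddCommGroup V] [Module F V]
    (A : Module.End F V) : Prop :=
  (⨆ μ : F, A.eigenspace μ) = ⊤ ∧
  ∀ μ : F, A.HasEigenvalue μ → Module.finrank F (A.eigenspace μ) = 1

/-- `A` is multiplicity-free, and `E 0, …, E d` are its primitive idempotents: there is an ordering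
`θ 0, …, θ d` of the eigenvalues of `A` such that `E i` is the identity on the eigenspace for `θ i`
and vanishes on the eigenspaces for `θ j`, `j ≠ i`. -/
def IsPrimitiveIdempotentOrdering {F V : Type*} [Field F] [AddCommGroup V] [Module F V] {d : ℕ}
    (A : Module.End F V) (E : Fin (d + 1) → Module.End F V) : Prop :=
  IsMultiplicityFree A ∧
  ∃ θ : Fin (d + 1) → F, Function.Injective θ ∧
    (∀ μ : F, A.HasEigenvalue μ ↔ ∃ i, θ i = μ) ∧
    (∀ i, ∀ v ∈ A.eigenspace (θ i), E i v = v) ∧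
    (∀ i j, j ≠ i → ∀ v ∈ A.eigenspace (θ j), E i v = 0)

/-- `E 0, …, E d` is a standard ordering of the primitive idempotents of `A`, for the pair
`A, A'`: vectors `v_i ∈ E_i V` form a basis with respect to which `A'` is irreducible tridiagonal
and `A` is diagonal. -/
def IsStandardOrdering {F V : Type*} [Field F] [AddCommGroup V] [Module F V] {d : ℕ}
    (A A' : Module.End F V) (E : Fin (d + 1) → Module.End F V) : Prop :=
  IsPrimitiveIdempotentOrdering A E ∧
  ∃ b : Module.Basis (Fin (d + 1)) F V,
    (∀ i, b i ∈ LinearMap.range (E i)) ∧ IsTridiagonalDiagonal b A' A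

/-- A sequence `(A; {E_i}; A*; {E*_i})` of elements of `End V`, with `0 ≤ i ≤ d`. -/
structure EndSeq (F V : Type*) [Field F] [AddCommGroup V] [Module F V] (d : ℕ) where
  A : Module.End F V
  E : Fin (d + 1) → Module.End F V
  Astar : Module.End F V
  Estar : Fin (d + 1) → Module.End F V

/-- The sequence `(A*; {E*_i}; A; {E_i})`. -/
def EndSeq.dual {F V : Type*} [Field F] [AddCommGroup V] [Module F V] {d : ℕ}
    (Φ : EndSeq F V d) : EndSeq F V d where
  A := Φ.Astar
  E := Φ.Estar
  Astar := Φ.A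
  Estar := Φ.E

/-- The sequence is a Leonard system on `V`. -/
def EndSeq.IsLeonardSystem {F V : Type*} [Field F] [AddCommGroup V] [Module F V] {d : ℕ}
    (Φ : EndSeq F V d) : Prop :=
  IsLeonardPair d Φ.A Φ.Astar ∧
  IsStandardOrdering Φ.A Φ.Astar Φ.E ∧
  IsStandardOrdering Φ.Astar Φ.A Φ.Estar

/-- There is an algebra isomorphism `End V → End V'` that carries `Φ` to `Φ'`. -/
def EndSeq.IsIsomorphic {F V V' : Type*} [Field F] [AddCommGroup V] [Module F V]
    [AddCommGroup V'] [Module F V'] {d : ℕ} (Φ : EndSeq F V d) (Φ' : EndSeq F V' d) : Prop :=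
  ∃ σ : Module.End F V ≃ₐ[F] Module.End F V',
    σ Φ.A = Φ'.A ∧ σ Φ.Astar = Φ'.Astar ∧
    (∀ i, σ (Φ.E i) = Φ'.E i) ∧ (∀ i, σ (Φ.Estar i) = Φ'.Estar i)

/-- A Leonard system that is isomorphic to its dual. -/
def EndSeq.IsSelfDualLeonardSystem {F V : Type*} [Field F] [AddCommGroup V] [Module F V] {d : ℕ}
    (Φ : EndSeq F V d) : Prop :=
  Φ.IsLeonardSystem ∧ Φ.IsIsomorphic Φ.dual

end Leonard

/-! ### Coordinates -/

section Coordinates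

open Classical in
/-- The coefficients of `w` with respect to a finite linearly independent family `b` whose span
contains `w` (and `0` if `w` is not in the span). -/
noncomputable def coord {ι W : Type*} [Fintype ι] [AddCommGroup W] [Module ℂ W]
    (b : ι → W) (w : W) : ι → ℂ :=
  if h : ∃ c : ι → ℂ, ∑ i, c i • b i = w then h.choose else 0

theorem sum_coord {ι W : Type*} [Fintype ι] [AddCommGroup W] [Module ℂ W]
    {b : ι → W} {w : W} (hw : w ∈ Submodule.span ℂ (Set.range b)) :
    ∑ i, coord b w i • b i = w := by
  have h : ∃ c : ι → ℂ, ∑ i, c i • b i = w := Submodule.mem_span_range_iff_exists_fun ℂ |>.1 hw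
  rw [coord, dif_pos h]
  exact h.choose_spec

theorem coord_eq {ι W : Type*} [Fintype ι] [AddCommGroup W] [Module ℂ W]
    {b : ι → W} (hb : LinearIndependent ℂ b) {w : W} {c : ι → ℂ} (hc : ∑ i, c i • b i = w) :
    coord b w = c := by
  have hw := sum_coord (b := b) (w := w)
    (Submodule.mem_span_range_iff_exists_fun ℂ |>.2 ⟨c, hc⟩)
  funext i
  have := Fintype.linearIndependent_iff.1 hb (fun i => coord b w i - c i)
    (by simp [sub_smul, Finset.sum_sub_distrib, hw, hc]) i
  exact sub_eq_zero.1 this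

end Coordinates

/-! ### Distance-regular graphs -/

section Graph

variable {X : Type*} [Fintype X] [DecidableEq X]

/-- The number of vertices at distance `i` from `x` and distance `j` from `y`. -/
noncomputable def intersectionCount (G : SimpleGraph X) (i j : ℕ) (x y : X) : ℕ :=
  (Finset.univ.filter fun z => G.dist x z = i ∧ G.dist y z = j).card

/-- A connected graph is distance-regular if, for `0 ≤ h, i, j ≤ D`, the number of vertices at
distance `i` from `x` and `j` from `y` is the same for all `x, y` at distance `h`. -/
def IsDistanceRegular (G : SimpleGraph X) : Prop :=
  G.Connected ∧
  ∀ h i j : ℕ, h ≤ G.diam → i ≤ G.diam → j ≤ G.diam →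
    ∃ p : ℕ, ∀ x y : X, G.dist x y = h → intersectionCount G i j x y = p

/-- The `i`-th distance-matrix. -/
noncomputable def distMatrix (G : SimpleGraph X) (i : ℕ) : Matrix X X ℂ :=
  Matrix.of fun x y => if G.dist x y = i then 1 else 0

/-- The distance-matrices `A_0, …, A_D`, where `D` is the diameter. -/
noncomputable def distFamily (G : SimpleGraph X) : Fin (G.diam + 1) → Matrix X X ℂ :=
  fun i => distMatrix G i

/-- The Bose-Mesner algebra: the span of the distance-matrices. -/
noncomputable def boseMesner (G : SimpleGraph X) : Submodule ℂ (Matrix X X ℂ) :=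
  Submodule.span ℂ (Set.range (distFamily G))

/-- `E 0, …, E D` is an ordering of the primitive idempotents of `G`, starting with the trivial
one: a basis of the Bose-Mesner algebra with `E_0 = |X|⁻¹ J`, `E_i E_j = δ_{ij} E_i` and
`∑ E_i = I`. -/
structure IsPrimitiveIdempotents (G : SimpleGraph X)
    (E : Fin (G.diam + 1) → Matrix X X ℂ) : Prop where
  linearIndependent : LinearIndependent ℂ E
  span_eq : Submodule.span ℂ (Set.range E) = boseMesner G
  zero : E 0 = (Fintype.card X : ℂ)⁻¹ • Matrix.of fun _ _ => (1 : ℂ)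
  mul : ∀ i j, E i * E j = if i = j then E i else 0
  sum : ∑ i, E i = 1

/-- The matrix `P`, with `A_j = ∑ i, P i j • E_i`. -/
noncomputable def matrixP (G : SimpleGraph X) (E : Fin (G.diam + 1) → Matrix X X ℂ) :
    Matrix (Fin (G.diam + 1)) (Fin (G.diam + 1)) ℂ :=
  Matrix.of fun i j => coord E (distFamily G j) i

/-- The matrix `Q`, with `E_j = |X|⁻¹ ∑ i, Q i j • A_i`. -/
noncomputable def matrixQ (G : SimpleGraph X) (E : Fin (G.diam + 1) → Matrix X X ℂ) :
    Matrix (Fin (G.diam + 1)) (Fin (G.diam + 1)) ℂ :=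
  Matrix.of fun i j => coord (distFamily G) ((Fintype.card X : ℂ) • E j) i

/-- The Krein parameter `q^h_{ij}`, with `E_i ∘ E_j = |X|⁻¹ ∑ h, q^h_{ij} • E_h`, where `∘` is the
entrywise product. -/
noncomputable def krein (G : SimpleGraph X) (E : Fin (G.diam + 1) → Matrix X X ℂ)
    (h i j : Fin (G.diam + 1)) : ℂ :=
  coord E ((Fintype.card X : ℂ) • (E i).hadamard (E j)) h

/-- The eigenvalue sequence `θ_i = P_{i1}` (used for `D ≥ 1`). -/
noncomputable def eigenvalueSeq (G : SimpleGraph X) (E : Fin (G.diam + 1) → Matrix X X ℂ)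
    (i : Fin (G.diam + 1)) : ℂ :=
  matrixP G E i 1

/-- The dual eigenvalue sequence `θ*_i = Q_{i1}` (used for `D ≥ 1`). -/
noncomputable def dualEigenvalueSeq (G : SimpleGraph X) (E : Fin (G.diam + 1) → Matrix X X ℂ)
    (i : Fin (G.diam + 1)) : ℂ :=
  matrixQ G E i 1

/-- `G` is formally self-dual with respect to the ordering `E`. -/
def IsFormallySelfDual (G : SimpleGraph X) (E : Fin (G.diam + 1) → Matrix X X ℂ) : Prop :=
  matrixP G E = matrixQ G E

/-- `G` is `Q`-polynomial with respect to the ordering `E`. -/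
def IsQPolynomial (G : SimpleGraph X) (E : Fin (G.diam + 1) → Matrix X X ℂ) : Prop :=
  ∀ h i j : Fin (G.diam + 1),
    (((h : ℕ) > i + j ∨ (i : ℕ) > h + j ∨ (j : ℕ) > h + i) → krein G E h i j = 0) ∧
    (((h : ℕ) = i + j ∨ (i : ℕ) = h + j ∨ (j : ℕ) = h + i) → krein G E h i j ≠ 0)

/-- The `i`-th dual primitive idempotent `E*_i(x)`. -/
noncomputable def dualIdempotent (G : SimpleGraph X) (x : X) (i : ℕ) : Matrix X X ℂ :=
  Matrix.diagonal fun y => if G.dist x y = i then 1 else 0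

/-- The dual distance-matrix `A*_i(x)` attached to `E_i`: the diagonal matrix whose `(y,y)`-entry
is the `(x,y)`-entry of `|X| E_i`. -/
noncomputable def dualDistMatrix (Ei : Matrix X X ℂ) (x : X) : Matrix X X ℂ :=
  Matrix.diagonal fun y => (Fintype.card X : ℂ) * Ei x y

/-- The dual Bose-Mesner algebra with respect to `x`: the span of the dual primitive idempotents. -/
noncomputable def dualBoseMesner (G : SimpleGraph X) (x : X) : Submodule ℂ (Matrix X X ℂ) :=
  Submodule.span ℂ (Set.range fun i : Fin (G.diam + 1) => dualIdempotent G x i)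

/-- The Terwilliger algebra with respect to `x`. -/
noncomputable def terwilliger (G : SimpleGraph X) (x : X) : Subalgebra ℂ (Matrix X X ℂ) :=
  Algebra.adjoin ℂ ((boseMesner G : Set (Matrix X X ℂ)) ∪ dualBoseMesner G x)

/-- A module for the Terwilliger algebra: a subspace of the space of column vectors that is
invariant under the algebra. -/
def IsTModule (G : SimpleGraph X) (x : X) (U : Submodule ℂ (X → ℂ)) : Prop :=
  ∀ B ∈ terwilliger G x, ∀ u ∈ U, B *ᵥ u ∈ U

/-- The primary module: the image of the Bose-Mesner algebra under `B ↦ B x̂`, where `x̂` is the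
characteristic vector of `x`. -/
noncomputable def primaryModule (G : SimpleGraph X) (x : X) : Submodule ℂ (X → ℂ) :=
  (boseMesner G).map ((Matrix.mulVecBilin ℂ ℂ).flip (Pi.single x 1 : X → ℂ))

/-- The matrix `B` leaves `U` invariant and acts on it as `f`. -/
def ActsAs {U : Submodule ℂ (X → ℂ)} (B : Matrix X X ℂ) (f : Module.End ℂ U) : Prop :=
  ∀ u : U, B *ᵥ (u : X → ℂ) = (f u : X → ℂ)

/-- The sequence `(A; {E_i}; A*; {E*_i})` of matrices acts on `U` as a self-dual Leonard system. -/
def ActsAsSelfDualLeonardSystem {d : ℕ} (U : Submodule ℂ (X → ℂ))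
    (A : Matrix X X ℂ) (E : Fin (d + 1) → Matrix X X ℂ)
    (Astar : Matrix X X ℂ) (Estar : Fin (d + 1) → Matrix X X ℂ) : Prop :=
  ∃ Φ : EndSeq ℂ U d,
    ActsAs A Φ.A ∧ (∀ i, ActsAs (E i) (Φ.E i)) ∧
    ActsAs Astar Φ.Astar ∧ (∀ i, ActsAs (Estar i) (Φ.Estar i)) ∧
    Φ.IsSelfDualLeonardSystem

end Graph

/-! ### The notions above are well defined -/

section WellDefined

theorem dist_le_diam {X : Type*} [Fintype X] {G : SimpleGraph X} (hG : G.Connected) (x y : X) :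
    G.dist x y ≤ G.diam := by
  have := hG.nonempty
  exact SimpleGraph.dist_le_diam (SimpleGraph.connected_iff_ediam_ne_top.1 hG)

/-- Every distance up to the diameter occurs. -/
theorem exists_dist_eq {X : Type*} [Fintype X] {G : SimpleGraph X} (hG : G.Connected) (i : ℕ)
    (hi : i ≤ G.diam) : ∃ x y, G.dist x y = i := by
  have := hG.nonempty
  obtain ⟨u, v, huv⟩ := G.exists_dist_eq_diam
  obtain ⟨p, hp⟩ := hG.exists_walk_length_eq_dist u v
  refine ⟨u, p.getVert i, ?_⟩
  have h1 := SimpleGraph.dist_le (p.take i)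
  have h2 := SimpleGraph.dist_le (p.drop i)
  have h3 := hG.dist_triangle (u := u) (v := p.getVert i) (w := v)
  rw [SimpleGraph.Walk.take_length] at h1
  rw [SimpleGraph.Walk.drop_length] at h2
  omega

theorem distFamily_linearIndependent {X : Type*} [Fintype X] {G : SimpleGraph X}
    (hG : G.Connected) : LinearIndependent ℂ (distFamily G) := by
  rw [Fintype.linearIndependent_iff]
  intro c hc i
  obtain ⟨x, y, hxy⟩ := exists_dist_eq hG i (by omega)
  have := congrFun (congrFun hc x) y
  simpa [Matrix.sum_apply, distFamily, distMatrix, hxy, Fin.val_inj] using this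

/-- The Bose-Mesner algebra consists of the matrices whose entries depend only on the distance. -/
theorem mem_boseMesner {X : Type*} [Fintype X] {G : SimpleGraph X} (hG : G.Connected)
    (B : Matrix X X ℂ) : B ∈ boseMesner G ↔ ∃ f : ℕ → ℂ, ∀ y z, B y z = f (G.dist y z) := by
  rw [boseMesner, Submodule.mem_span_range_iff_exists_fun]
  constructor
  · rintro ⟨c, rfl⟩
    refine ⟨fun n => ∑ i : Fin (G.diam + 1), if n = i then c i else 0, fun y z => ?_⟩
    simp [Matrix.sum_apply, distFamily, distMatrix]
  · rintro ⟨f, hf⟩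
    refine ⟨fun i => f i, ?_⟩
    ext y z
    have h : ∀ i : Fin (G.diam + 1), (G.dist y z = i) ↔
        (⟨G.dist y z, Nat.lt_succ_of_le (dist_le_diam hG y z)⟩ : Fin (G.diam + 1)) = i := by
      intro i; simp [Fin.ext_iff]
    simp [Matrix.sum_apply, distFamily, distMatrix, hf, h]

theorem distFamily_eq_sum {X : Type*} [Fintype X] [DecidableEq X] {G : SimpleGraph X}
    {E : Fin (G.diam + 1) → Matrix X X ℂ} (hE : IsPrimitiveIdempotents G E)
    (j : Fin (G.diam + 1)) : distFamily G j = ∑ i, matrixP G E i j • E i := by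
  refine (sum_coord (b := E) ?_).symm
  rw [hE.span_eq]
  exact Submodule.subset_span ⟨j, rfl⟩

theorem mem_boseMesner_of_isPrimitiveIdempotents {X : Type*} [Fintype X] [DecidableEq X]
    {G : SimpleGraph X} {E : Fin (G.diam + 1) → Matrix X X ℂ} (hE : IsPrimitiveIdempotents G E)
    (j : Fin (G.diam + 1)) : E j ∈ boseMesner G := by
  rw [← hE.span_eq]
  exact Submodule.subset_span ⟨j, rfl⟩

theorem idempotent_eq_sum {X : Type*} [Fintype X] [DecidableEq X] {G : SimpleGraph X}
    (hG : G.Connected) {E : Fin (G.diam + 1) → Matrix X X ℂ} (hE : IsPrimitiveIdempotents G E)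
    (j : Fin (G.diam + 1)) :
    E j = (Fintype.card X : ℂ)⁻¹ • ∑ i, matrixQ G E i j • distFamily G i := by
  have := hG.nonempty
  have h := sum_coord (b := distFamily G) (w := (Fintype.card X : ℂ) • E j)
    ((boseMesner G).smul_mem _ (mem_boseMesner_of_isPrimitiveIdempotents hE j))
  have h0 : (Fintype.card X : ℂ) ≠ 0 := Nat.cast_ne_zero.2 Fintype.card_ne_zero
  rw [eq_inv_smul_iff₀ h0]
  exact h.symm

theorem hadamard_eq_sum {X : Type*} [Fintype X] [DecidableEq X] {G : SimpleGraph X}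
    (hG : G.Connected) {E : Fin (G.diam + 1) → Matrix X X ℂ} (hE : IsPrimitiveIdempotents G E)
    (i j : Fin (G.diam + 1)) :
    (E i).hadamard (E j) = (Fintype.card X : ℂ)⁻¹ • ∑ h, krein G E h i j • E h := by
  have := hG.nonempty
  have h0 : (Fintype.card X : ℂ) ≠ 0 := Nat.cast_ne_zero.2 Fintype.card_ne_zero
  rw [eq_inv_smul_iff₀ h0]
  refine (sum_coord (b := E) ?_).symm
  rw [hE.span_eq]
  refine (boseMesner G).smul_mem _ ?_
  obtain ⟨f, hf⟩ := (mem_boseMesner hG _).1 (mem_boseMesner_of_isPrimitiveIdempotents hE i)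
  obtain ⟨g, hg⟩ := (mem_boseMesner hG _).1 (mem_boseMesner_of_isPrimitiveIdempotents hE j)
  exact (mem_boseMesner hG _).2 ⟨fun n => f n * g n, fun y z => by simp [hf, hg]⟩

/-- The primary module consists of the vectors whose entries depend only on the distance to `x`. -/
theorem mem_primaryModule {X : Type*} [Fintype X] [DecidableEq X] {G : SimpleGraph X}
    (hG : G.Connected) (x : X) (u : X → ℂ) :
    u ∈ primaryModule G x ↔ ∃ f : ℕ → ℂ, ∀ y, u y = f (G.dist x y) := by
  rw [primaryModule, Submodule.mem_map]
  constructor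
  · rintro ⟨B, hB, rfl⟩
    obtain ⟨f, hf⟩ := (mem_boseMesner hG B).1 hB
    exact ⟨f, fun y => by simp [hf, SimpleGraph.dist_comm]⟩
  · rintro ⟨f, hf⟩
    refine ⟨Matrix.of fun y z => f (G.dist y z), (mem_boseMesner hG _).2 ⟨f, fun _ _ => rfl⟩, ?_⟩
    ext y
    simp [hf, SimpleGraph.dist_comm]

theorem mul_mem_boseMesner {X : Type*} [Fintype X] [DecidableEq X] {G : SimpleGraph X}
    (hG : IsDistanceRegular G) {B C : Matrix X X ℂ} (hB : B ∈ boseMesner G)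
    (hC : C ∈ boseMesner G) : B * C ∈ boseMesner G := by
  have key : ∀ i j : Fin (G.diam + 1), distFamily G i * distFamily G j ∈ boseMesner G := by
    intro i j
    have h := fun n : ℕ => hG.2 n i j
    choose! p hp using h
    refine (mem_boseMesner hG.1 _).2 ⟨fun n => p n, fun y z => ?_⟩
    have h := hp _ (dist_le_diam hG.1 y z) (by omega) (by omega) y z rfl
    change _ = (p (G.dist y z) : ℂ)
    rw [← h]
    simp [Matrix.mul_apply, distFamily, distMatrix, intersectionCount, ← ite_and,
      SimpleGraph.dist_comm (u := z), Finset.sum_boole]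
    congr 1
    ext w
    rw [Finset.mem_filter, Finset.mem_filter]
    tauto
  obtain ⟨b, rfl⟩ := (Submodule.mem_span_range_iff_exists_fun ℂ).1 hB
  obtain ⟨c, rfl⟩ := (Submodule.mem_span_range_iff_exists_fun ℂ).1 hC
  rw [Finset.sum_mul]
  refine Submodule.sum_mem _ fun i _ => ?_
  rw [Finset.mul_sum]
  refine Submodule.sum_mem _ fun j _ => ?_
  rw [Matrix.smul_mul, Matrix.mul_smul]
  exact Submodule.smul_mem _ _ (Submodule.smul_mem _ _ (key i j))

theorem primaryModule_isTModule {X : Type*} [Fintype X] [DecidableEq X] {G : SimpleGraph X}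
    (hG : IsDistanceRegular G) (x : X) : IsTModule G x (primaryModule G x) := by
  intro B hB
  induction hB using Algebra.adjoin_induction with
  | mem B hB =>
    rintro u hu
    rcases hB with hB | hB
    · obtain ⟨C, hC, rfl⟩ := Submodule.mem_map.1 hu
      exact Submodule.mem_map.2 ⟨B * C, mul_mem_boseMesner hG hB hC, by simp⟩
    · obtain ⟨c, rfl⟩ := (Submodule.mem_span_range_iff_exists_fun ℂ).1 hB
      obtain ⟨f, hf⟩ := (mem_primaryModule hG.1 x u).1 hu
      refine (mem_primaryModule hG.1 x _).2
        ⟨fun n => (∑ i : Fin (G.diam + 1), if n = i then c i else 0) * f n, fun y => ?_⟩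
      simp [Matrix.sum_mulVec, Matrix.smul_mulVec, dualIdempotent, Matrix.mulVec_diagonal, hf,
        Finset.sum_mul]
  | algebraMap r =>
    intro u hu
    rw [Algebra.algebraMap_eq_smul_one, Matrix.smul_mulVec, Matrix.one_mulVec]
    exact Submodule.smul_mem _ _ hu
  | add B C _ _ hB hC =>
    intro u hu
    rw [Matrix.add_mulVec]
    exact Submodule.add_mem _ (hB u hu) (hC u hu)
  | mul B C _ _ hB hC =>
    intro u hu
    rw [← Matrix.mulVec_mulVec]
    exact hB _ (hC u hu)

end WellDefined

end LeonardDRG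

namespace LeonardDRG

/-! ### Pairs of mutually dual character tables -/

section CharacterPair

/-! Write $N=|X|$, $k_j=P_{0j}$, $m_i=Q_{0i}$. The tables $P,Q$ satisfy $PQ=QP=NI$, have a first
column of ones, and obey $m_iP_{ij}=k_jQ_{ji}$. These relations (`IsCharacterPair`) are symmetric in
$P$ and $Q$. The intersection numbers and the Krein parameters are the same expression
`structureConst` with $P$ and $Q$ exchanged, and the intersection numbers always satisfy the
triangle condition. Hence $P=Q$ gives the $Q$-polynomial property and $\theta_i=\theta^*_i$ at once.

The converse (`IsCharacterPair.eq_of_isTriangular`) uses $U_{ij}=P_{ij}/k_j=Q_{ji}/m_i$. Its rows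
satisfy a three-term recurrence with coefficients $p^j_{1h}$ and its columns one with coefficients
$q^j_{1h}$. If $\theta=\theta^*$, rows 0 and 1 of $U$ equal columns 0 and 1, so each row of
$(p^j_{1h}-q^j_{1h})_{j,h}$ is orthogonal to $1$ and to $\theta$. Since $p^1_{10}=q^1_{10}=1$, this
settles row 1. Then row 2 and column 2 of $U$ are the same quadratic in $\theta$, so every row of
the difference is orthogonal to $1,\theta,\theta^2$. A row has at most three possible nonzero
entries and the $\theta_i$ are distinct, so the difference vanishes, and the common recurrence gives
$P=Q$.

For the Leonard system, $U=M\hat x$ has the bases $E_i\hat x$ and $A_i\hat x$, with transition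
matrices $P$ and $Q$ up to the factor $N$. On them $A_1$ and $A^*_1$ are diagonal or tridiagonal,
with entries taken from $P$, $Q$, $p$, $q$. If $P=Q$, the map $E_i\hat x\mapsto A_i\hat x$ squares
to $N$, and conjugation by it is the required duality (`EndSeq.isSelfDualLeonardSystem_of_bases`).
Conversely, a duality is conjugation by some $S$ that exchanges the two bases up to scalars; the
columns of ones make these scalars constant, which forces $P=Q$ (`transition_eq_of_algEquiv`). -/

/-- A family supported on `s` that is orthogonal to all powers `θ ^ k` with `k < #s` vanishes. -/
theorem eq_zero_of_sum_mul_pow_eq_zero {ι : Type*} [DecidableEq ι] {θ : ι → ℂ}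
    (hθ : Function.Injective θ) (s : Finset ι) (v : ι → ℂ)
    (h : ∀ k < s.card, ∑ i ∈ s, v i * θ i ^ k = 0) {a : ι} (ha : a ∈ s) : v a = 0 := by
  -- The unnormalised Lagrange polynomial at `a`: its degree is below `s.card`, and it isolates the
  -- term `v a`.
  set f : Polynomial ℂ := ∏ i ∈ s.erase a, (Polynomial.X - Polynomial.C (θ i)) with hf
  have hdeg : f.natDegree < s.card := by
    rw [hf, Polynomial.natDegree_prod_of_monic _ _ fun i _ => Polynomial.monic_X_sub_C _]
    simpa using Finset.card_erase_lt_of_mem ha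
  have hsum : ∑ i ∈ s, v i * f.eval (θ i) = 0 := by
    simp_rw [Polynomial.eval_eq_sum_range' hdeg, Finset.mul_sum]
    rw [Finset.sum_comm]
    refine Finset.sum_eq_zero fun k hk => ?_
    have := h k (Finset.mem_range.1 hk)
    calc _ = f.coeff k * ∑ i ∈ s, v i * θ i ^ k := by
          rw [Finset.mul_sum]; exact Finset.sum_congr rfl fun i _ => by ring
      _ = 0 := by rw [this, mul_zero]
  have heval : ∀ i, f.eval (θ i) = ∏ j ∈ s.erase a, (θ i - θ j) := fun i => by
    simp [hf, Polynomial.eval_prod]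
  rw [Finset.sum_eq_single_of_mem a ha] at hsum
  · refine (mul_eq_zero.1 hsum).resolve_right ?_
    rw [heval]
    refine Finset.prod_ne_zero_iff.2 fun j hj => ?_
    exact sub_ne_zero.2 fun e => Finset.ne_of_mem_erase hj (hθ e).symm
  · intro i hi hia
    rw [heval, Finset.prod_eq_zero (Finset.mem_erase.2 ⟨hia, hi⟩) (sub_self _), mul_zero]

variable {D : ℕ}

/-- The triangle condition on an array of structure constants `p h i j`: the entry vanishes when one
index exceeds the sum of the other two, and does not vanish in the case of equality. -/
def IsTriangular (p : Fin (D + 1) → Fin (D + 1) → Fin (D + 1) → ℂ) : Prop :=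
  ∀ h i j : Fin (D + 1),
    (((h : ℕ) > i + j ∨ (i : ℕ) > h + j ∨ (j : ℕ) > h + i) → p h i j = 0) ∧
    (((h : ℕ) = i + j ∨ (i : ℕ) = h + j ∨ (j : ℕ) = h + i) → p h i j ≠ 0)

/-- The structure constants of the algebra with character tables `P` and `Q`. -/
noncomputable def structureConst (N : ℂ) (P Q : Matrix (Fin (D + 1)) (Fin (D + 1)) ℂ)
    (h i j : Fin (D + 1)) : ℂ :=
  N⁻¹ * ∑ t, Q h t * P t i * P t j

/-- The relations between the eigenmatrices `P` and `Q` of a symmetric association scheme on `N`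
points. -/
structure IsCharacterPair (N : ℂ) (P Q : Matrix (Fin (D + 1)) (Fin (D + 1)) ℂ) : Prop where
  ne_zero : N ≠ 0
  mul : P * Q = N • 1
  mul_swap : Q * P = N • 1
  left_zero : ∀ i, P i 0 = 1
  right_zero : ∀ i, Q i 0 = 1
  balance : ∀ i j, Q 0 i * P i j = P 0 j * Q j i
  left_ne : ∀ j, P 0 j ≠ 0
  right_ne : ∀ j, Q 0 j ≠ 0

variable {N : ℂ} {P Q : Matrix (Fin (D + 1)) (Fin (D + 1)) ℂ}

/-- This duality carries each result on intersection numbers over to Krein parameters. -/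
theorem IsCharacterPair.symm (H : IsCharacterPair N P Q) : IsCharacterPair N Q P :=
  ⟨H.ne_zero, H.mul_swap, H.mul, H.right_zero, H.left_zero, fun i j => (H.balance j i).symm,
    H.right_ne, H.left_ne⟩

theorem IsCharacterPair.sum_mul_structureConst (H : IsCharacterPair N P Q)
    (t i j : Fin (D + 1)) :
    ∑ h, P t h * structureConst N P Q h i j = P t i * P t j := by
  have h1 : ∀ s, ∑ h, P t h * Q h s = if t = s then N else 0 := fun s => by
    have := congrFun (congrFun H.mul t) s
    simpa [Matrix.mul_apply, Matrix.one_apply] using this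
  calc ∑ h, P t h * structureConst N P Q h i j
      = N⁻¹ * ∑ s, (∑ h, P t h * Q h s) * (P s i * P s j) := by
        simp_rw [structureConst, Finset.sum_mul, Finset.mul_sum]
        rw [Finset.sum_comm]
        exact Finset.sum_congr rfl fun s _ => Finset.sum_congr rfl fun h _ => by ring
    _ = _ := by
        have := H.ne_zero
        simp [h1, this]

/-- By `balance`, both sides equal $N^{-1}\sum_t Q_{0t}P_{th}P_{ti}P_{tj}$, which is symmetric in
$h,i,j$. -/
theorem IsCharacterPair.mul_structureConst (H : IsCharacterPair N P Q) (h i j : Fin (D + 1)) :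
    P 0 h * structureConst N P Q h i j = P 0 j * structureConst N P Q j i h := by
  simp only [structureConst, Finset.mul_sum]
  refine Finset.sum_congr rfl fun t _ => ?_
  linear_combination (-N⁻¹ * P t i * P t j) * H.balance t h + (N⁻¹ * P t i * P t h) * H.balance t j

theorem IsCharacterPair.structureConst_zero (H : IsCharacterPair N P Q) (h i : Fin (D + 1)) :
    structureConst N P Q h i 0 = if h = i then 1 else 0 := by
  have := congrFun (congrFun H.mul_swap h) i
  have h0 := H.ne_zero
  simp only [Matrix.mul_apply, Matrix.smul_apply, Matrix.one_apply] at this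
  simp only [structureConst, H.left_zero, mul_one, this]
  split_ifs <;> simp [h0]

/-- The normalized eigenmatrix satisfies the recurrence with transposed coefficients. -/
theorem IsCharacterPair.sum_structureConst_mul_div (H : IsCharacterPair N P Q)
    (i k j : Fin (D + 1)) :
    ∑ h, structureConst N P Q j k h * (P i h / P 0 h) = P i k * (P i j / P 0 j) := by
  have hj := H.left_ne j
  rw [← mul_div_assoc, ← H.sum_mul_structureConst i k j, Finset.sum_div]
  refine Finset.sum_congr rfl fun h _ => ?_
  have hh := H.left_ne h
  have := H.mul_structureConst h k j
  field_simp
  linear_combination (-P i h) * this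

/-- For `D = 0` the numeral `1` of `Fin (D + 1)` wraps round to `0`. -/
theorem val_one (hD : 1 ≤ D) : ((1 : Fin (D + 1)) : ℕ) = 1 := by
  rw [Fin.val_one', Nat.mod_eq_of_lt (by omega)]

/-- A three-term recurrence with nonvanishing leading coefficients determines its solution. -/
theorem eq_of_recurrence (hD : 1 ≤ D) {p : Fin (D + 1) → Fin (D + 1) → Fin (D + 1) → ℂ}
    (hp : IsTriangular p) (c : ℂ) {f g : Fin (D + 1) → ℂ} (h0 : f 0 = g 0)
    (hf : ∀ j, ∑ h, f h * p h 1 j = c * f j) (hg : ∀ j, ∑ h, g h * p h 1 j = c * g j) :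
    f = g := by
  have v1 := val_one hD
  have key : ∀ n : ℕ, ∀ j : Fin (D + 1), (j : ℕ) = n → f j = g j := by
    intro n
    induction n using Nat.strong_induction_on with
    | _ n ih =>
      intro j hj
      rcases Nat.eq_zero_or_pos n with rfl | hn
      · have : j = 0 := Fin.ext hj
        rw [this, h0]
      -- The recurrence at `n - 1` involves only indices up to `n`, and the value at `n` enters with
      -- a nonzero coefficient.
      · let i : Fin (D + 1) := ⟨n - 1, by omega⟩
        have hi : (i : ℕ) = n - 1 := rfl
        have e : ∑ h, (f h - g h) * p h 1 i = 0 := by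
          simp_rw [sub_mul, Finset.sum_sub_distrib, hf, hg, ih (n - 1) (by omega) i rfl, sub_self]
        rw [Finset.sum_eq_single_of_mem j (Finset.mem_univ _)] at e
        · exact sub_eq_zero.1 ((mul_eq_zero.1 e).resolve_right ((hp j 1 i).2 (by omega)))
        · intro h _ hne
          have hne : (h : ℕ) ≠ j := fun e => hne (Fin.ext e)
          rcases lt_or_ge (h : ℕ) n with hlt | hge
          · rw [ih h hlt h rfl, sub_self, zero_mul]
          · rw [(hp h 1 i).1 (by omega), mul_zero]
  exact funext fun j => key j j rfl

/-- A row of `P` starts with 1 and is determined by its eigenvalue through the recurrence. Equal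
eigenvalues would give equal rows of an invertible matrix. -/
theorem IsCharacterPair.injective (H : IsCharacterPair N P Q) (hD : 1 ≤ D)
    (hp : IsTriangular (structureConst N P Q)) : Function.Injective fun i => P i 1 := by
  intro i j hij
  have hrow : P i = P j := by
    refine eq_of_recurrence hD hp (P i 1) ?_ (fun k => H.sum_mul_structureConst i 1 k) fun k => ?_
    · rw [H.left_zero, H.left_zero]
    · rw [H.sum_mul_structureConst j 1 k, show P i 1 = P j 1 from hij]
  by_contra hne
  have h1 := congrFun (congrFun H.mul i) j
  have h2 := congrFun (congrFun H.mul j) j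
  rw [Matrix.mul_apply'] at h1 h2
  rw [hrow, h2] at h1
  simp [hne, H.ne_zero] at h1

/-- Two `P`- and `Q`-polynomial eigenmatrices with the same eigenvalue sequences agree. -/
theorem IsCharacterPair.eq_of_isTriangular (H : IsCharacterPair N P Q) (hD : 1 ≤ D)
    (hp : IsTriangular (structureConst N P Q)) (hq : IsTriangular (structureConst N Q P))
    (hθ : ∀ i, P i 1 = Q i 1) : P = Q := by
  have v1 := val_one hD
  have hinj := H.injective hD hp
  set p := structureConst N P Q with hpdef
  set q := structureConst N Q P with hqdef
  set θ : Fin (D + 1) → ℂ := fun i => P i 1 with hθdef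
  set U : Fin (D + 1) → Fin (D + 1) → ℂ := fun i j => P i j / P 0 j with hU
  have hU' : ∀ i j, U i j = Q j i / Q 0 i := fun i j => by
    have := H.left_ne j
    have := H.right_ne i
    have := H.balance i j
    simp only [hU]
    field_simp
    linear_combination this
  -- `R` is a recurrence along rows of `U`, `R'` one along columns. Wherever a row of `U` equals the
  -- column of the same index, their difference is a linear relation on `p j 1 h - q j 1 h`.
  have R : ∀ i j, ∑ h, p j 1 h * U i h = θ i * U i j :=
    fun i j => H.sum_structureConst_mul_div i 1 j
  have R' : ∀ i j, ∑ h, q i 1 h * U h j = θ j * U i j := fun i j => by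
    simp_rw [hU', hθdef, hθ]
    exact H.symm.sum_structureConst_mul_div j 1 i
  have hk : θ 0 ≠ 0 := H.left_ne 1
  have U1 : ∀ i, U i 1 = θ i / θ 0 := fun i => rfl
  have U1' : ∀ i, U 1 i = θ i / θ 0 := fun i => by
    simp only [hU', hθdef, hθ]
  have U0 : ∀ i, U i 0 = 1 := fun i => by simp [hU, H.left_zero]
  have U0' : ∀ i, U 0 i = 1 := fun i => by simp [hU', H.right_zero]
  have S0 : ∀ j, ∑ h, (p j 1 h - q j 1 h) = 0 := fun j => by
    have h1 := R 0 j
    have h2 := R' j 0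
    simp only [U0, U0', mul_one] at h1 h2
    rw [Finset.sum_sub_distrib, h1, h2, sub_self]
  have S1 : ∀ j, ∑ h, (p j 1 h - q j 1 h) * θ h = 0 := fun j => by
    have h1 := R 1 j
    have h2 := R' j 1
    simp only [U1, U1', mul_div_assoc'] at h1 h2
    rw [← Finset.sum_div, div_left_inj' hk] at h1 h2
    simp only [sub_mul]
    rw [Finset.sum_sub_distrib, h1, h2, sub_self]
  have restrict : ∀ j (s : Finset (Fin (D + 1))) (f : Fin (D + 1) → ℂ),
      (∀ h ∉ s, p j 1 h - q j 1 h = 0) →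
      ∑ h ∈ s, (p j 1 h - q j 1 h) * f h = ∑ h, (p j 1 h - q j 1 h) * f h :=
    fun j s f hs => Finset.sum_subset (Finset.subset_univ s) fun h _ hh => by
      rw [hs h hh, zero_mul]
  have far : ∀ j h : Fin (D + 1), ((h : ℕ) > j + 1 ∨ (j : ℕ) > h + 1) →
      p j 1 h - q j 1 h = 0 := fun j h hjh => by
    rw [(hp j 1 h).1 (by omega), (hq j 1 h).1 (by omega), sub_self]
  have vanish : ∀ j (s : Finset (Fin (D + 1))), (∀ h ∉ s, p j 1 h - q j 1 h = 0) →
      (∀ k < s.card, ∑ h, (p j 1 h - q j 1 h) * θ h ^ k = 0) → ∀ h, p j 1 h = q j 1 h := by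
    intro j s hs hsum h
    rw [← sub_eq_zero]
    by_cases hh : h ∈ s
    · exact eq_zero_of_sum_mul_pow_eq_zero hinj s (fun h => p j 1 h - q j 1 h)
        (fun k hk => by rw [restrict j s _ hs, hsum k hk]) hh
    · exact hs h hh
  have S01 : ∀ j, ∀ k < 2, ∑ h, (p j 1 h - q j 1 h) * θ h ^ k = 0 := fun j k hk => by
    interval_cases k
    · simpa using S0 j
    · simpa using S1 j
  have hpq : ∀ j h, p j 1 h = q j 1 h := by
    rcases hD.eq_or_lt with hD1 | hD2
    · intro j
      refine vanish j Finset.univ (by simp) fun k hk => S01 j k ?_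
      simpa [← hD1] using hk
    · let two : Fin (D + 1) := ⟨2, by omega⟩
      have v2 : (two : ℕ) = 2 := rfl
      have n12 : (1 : Fin (D + 1)) ≠ two := fun e => by rw [Fin.ext_iff] at e; omega
      have hp0 : p 1 1 0 = 1 := by simp [hpdef, H.structureConst_zero]
      have hq0 : q 1 1 0 = 1 := by simp [hqdef, H.symm.structureConst_zero]
      -- The entry at 0 is known to agree, so two unknowns remain and the relations `S0`, `S1`
      -- suffice.
      have row1 : ∀ h, p 1 1 h = q 1 1 h := by
        refine vanish 1 {1, two} (fun h hh => ?_) fun k hk => S01 1 k ?_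
        · rw [Finset.mem_insert, Finset.mem_singleton, not_or, Fin.ext_iff, Fin.ext_iff] at hh
          rcases Nat.eq_zero_or_pos (h : ℕ) with h0 | h0
          · rw [show h = 0 from Fin.ext h0, hp0, hq0, sub_self]
          · exact far 1 h (by omega)
        · rwa [Finset.card_pair n12] at hk
      have split : ∀ f : Fin (D + 1) → ℂ,
          ∑ h, q 1 1 h * f h = f 0 + q 1 1 1 * f 1 + q 1 1 two * f two := by
        intro f
        have n01 : (0 : Fin (D + 1)) ∉ ({1, two} : Finset (Fin (D + 1))) := by
          rw [Finset.mem_insert, Finset.mem_singleton, Fin.ext_iff, Fin.ext_iff]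
          simp only [Fin.val_zero]
          omega
        rw [← Finset.sum_subset (Finset.subset_univ {0, 1, two}), Finset.sum_insert n01,
          Finset.sum_pair n12, hq0, one_mul, add_assoc]
        intro h _ hh
        simp only [Finset.mem_insert, Finset.mem_singleton, Fin.ext_iff, Fin.val_zero] at hh
        rw [(hq 1 1 h).1 (by omega), zero_mul]
      have hb : q 1 1 two ≠ 0 := (hq 1 1 two).2 (by omega)
      have T : ∀ j, q 1 1 two * U two j = θ j * (θ j / θ 0) - 1 - q 1 1 1 * (θ j / θ 0) := by
        intro j
        have := R' 1 j
        rw [split fun h => U h j, U0', U1'] at this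
        linear_combination this
      -- With row 1 of `p` and `q` equal, `R` and `R'` express `U i two` and `U two i` by the same
      -- quadratic in `θ i`.
      have T' : ∀ i, U i two = U two i := by
        intro i
        have := R i 1
        simp only [row1] at this
        rw [split fun h => U i h, U0, U1] at this
        exact mul_left_cancel₀ hb (by linear_combination this - T i)
      have S2 : ∀ j, ∑ h, (p j 1 h - q j 1 h) * θ h ^ 2 = 0 := by
        intro j
        have h1 := R two j
        have h2 := R' j two
        simp only [T'] at h2
        have h3 : ∑ h, (p j 1 h - q j 1 h) * U two h = 0 := by
          simp only [sub_mul]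
          rw [Finset.sum_sub_distrib, h1, h2, sub_self]
        have h4 : ∀ h, θ h ^ 2 = θ 0 * q 1 1 two * U two h + θ 0 + q 1 1 1 * θ h := fun h => by
          have := T h
          field_simp at this
          linear_combination -this
        calc _ = ∑ h, (θ 0 * q 1 1 two * ((p j 1 h - q j 1 h) * U two h)
              + θ 0 * (p j 1 h - q j 1 h) + q 1 1 1 * ((p j 1 h - q j 1 h) * θ h)) :=
              Finset.sum_congr rfl fun h _ => by rw [h4]; ring
          _ = 0 := by
              rw [Finset.sum_add_distrib, Finset.sum_add_distrib, ← Finset.mul_sum,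
                ← Finset.mul_sum, ← Finset.mul_sum, h3, S0, S1]
              ring
      intro j
      -- The support lies in `{j - 1, j, j + 1}`, so the moments of order 0, 1, 2 are enough.
      refine vanish j (Finset.univ.filter fun h => (h : ℕ) ≤ j + 1 ∧ (j : ℕ) ≤ h + 1)
        (fun h hh => far j h ?_) fun k hk => ?_
      · rw [Finset.mem_filter] at hh
        simp only [Finset.mem_univ, true_and] at hh
        omega
      · have hcard : (Finset.univ.filter fun h : Fin (D + 1) =>
            (h : ℕ) ≤ j + 1 ∧ (j : ℕ) ≤ h + 1).card ≤ 3 := by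
          rw [← Finset.card_map Fin.valEmbedding]
          refine (Finset.card_le_card (t := {(j : ℕ) - 1, (j : ℕ), (j : ℕ) + 1}) ?_).trans
            Finset.card_le_three
          intro n hn
          simp only [Finset.mem_map, Finset.mem_filter, Finset.mem_univ, true_and,
            Fin.valEmbedding_apply] at hn
          obtain ⟨h, hh, rfl⟩ := hn
          simp only [Finset.mem_insert, Finset.mem_singleton]
          omega
        rcases Nat.lt_or_ge k 2 with hk2 | hk2
        · exact S01 j k hk2
        · rw [show k = 2 by omega]
          exact S2 j
  funext i
  refine eq_of_recurrence hD hp (θ i) ?_ (fun j => H.sum_mul_structureConst i 1 j) fun j => ?_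
  · rw [H.left_zero, H.right_zero]
  · simp only [hpq]
    rw [H.symm.sum_mul_structureConst i 1 j, ← hθ]

end CharacterPair

end LeonardDRG

namespace LeonardDRG

/-! ### Eigenmatrices of a distance-regular graph -/

section Eigenmatrices

theorem distFamily_zero {X : Type*} [DecidableEq X] {G : SimpleGraph X} (hG : G.Connected) : distFamily G 0 = 1 := by
  ext y z
  simp [distFamily, distMatrix, Matrix.one_apply, hG.dist_eq_zero_iff]

variable {X : Type*} [Fintype X] {G : SimpleGraph X}

/-- The distance between two vertices, as an index. -/
noncomputable def distIndex (hG : G.Connected) (y z : X) : Fin (G.diam + 1) :=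
  ⟨G.dist y z, Nat.lt_succ_of_le (dist_le_diam hG y z)⟩

theorem distFamily_apply (hG : G.Connected) (i : Fin (G.diam + 1)) (y z : X) :
    distFamily G i y z = if distIndex hG y z = i then 1 else 0 := by
  simp [distFamily, distMatrix, distIndex, Fin.ext_iff]

theorem distIndex_comm (hG : G.Connected) (y z : X) : distIndex hG y z = distIndex hG z y :=
  Fin.ext (SimpleGraph.dist_comm)

theorem exists_distIndex_eq (hG : G.Connected) (i : Fin (G.diam + 1)) :
    ∃ y z, distIndex hG y z = i := by
  obtain ⟨y, z, h⟩ := exists_dist_eq hG i (by omega)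
  exact ⟨y, z, Fin.ext h⟩

theorem sum_smul_distFamily_apply (hG : G.Connected) (c : Fin (G.diam + 1) → ℂ) (y z : X) :
    (∑ i, c i • distFamily G i) y z = c (distIndex hG y z) := by
  simp [Matrix.sum_apply, distFamily_apply hG]

theorem card_ne_zero_of_connected (hG : G.Connected) : (Fintype.card X : ℂ) ≠ 0 := by
  have := hG.nonempty
  exact Nat.cast_ne_zero.2 Fintype.card_ne_zero

/-- On a geodesic of length `i + j` there is a vertex at distances `i` and `j` from the ends. -/
theorem exists_distIndex_between (hG : G.Connected) {h i j : Fin (G.diam + 1)}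
    (hij : (h : ℕ) = i + j) :
    ∃ y z w, distIndex hG y z = h ∧ distIndex hG y w = i ∧ distIndex hG w z = j := by
  obtain ⟨y, z, hyz⟩ := exists_dist_eq hG h (by omega)
  obtain ⟨p, hp⟩ := hG.exists_walk_length_eq_dist y z
  have h1 := SimpleGraph.dist_le (p.take i)
  have h2 := SimpleGraph.dist_le (p.drop i)
  have h3 := hG.dist_triangle (u := y) (v := p.getVert i) (w := z)
  rw [SimpleGraph.Walk.take_length] at h1
  rw [SimpleGraph.Walk.drop_length] at h2
  refine ⟨y, z, p.getVert i, Fin.ext hyz, Fin.ext ?_, Fin.ext ?_⟩ <;> simp only [distIndex] <;>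
    omega

variable [DecidableEq X] {E : Fin (G.diam + 1) → Matrix X X ℂ}

theorem idempotent_apply (hG : G.Connected) (hE : IsPrimitiveIdempotents G E)
    (j : Fin (G.diam + 1)) (y z : X) :
    E j y z = (Fintype.card X : ℂ)⁻¹ * matrixQ G E (distIndex hG y z) j := by
  conv_lhs => rw [idempotent_eq_sum hG hE j]
  rw [Matrix.smul_apply, sum_smul_distFamily_apply hG fun i => matrixQ G E i j, smul_eq_mul]

theorem distFamily_mul_idempotent (hE : IsPrimitiveIdempotents G E) (i j : Fin (G.diam + 1)) :
    distFamily G j * E i = matrixP G E i j • E i := by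
  rw [distFamily_eq_sum hE j, Finset.sum_mul]
  simp [hE.mul]

theorem sum_distFamily_apply (hG : G.Connected) (hE : IsPrimitiveIdempotents G E)
    (j : Fin (G.diam + 1)) (y : X) : ∑ z, distFamily G j y z = matrixP G E 0 j := by
  have h := congrFun (congrFun (distFamily_mul_idempotent hE 0 j) y) y
  have h0 := card_ne_zero_of_connected hG
  rw [hE.zero, Matrix.mul_apply] at h
  simp only [Matrix.smul_apply, Matrix.of_apply, smul_eq_mul, mul_one] at h
  rw [← Finset.sum_mul] at h
  exact mul_right_cancel₀ (inv_ne_zero h0) h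

/-- Up to the factor $N$, `P` and `Q` are inverse changes of basis in the Bose-Mesner algebra. -/
theorem matrixP_mul_matrixQ (hG : G.Connected) (hE : IsPrimitiveIdempotents G E) :
    matrixP G E * matrixQ G E = (Fintype.card X : ℂ) • 1 := by
  have h0 := card_ne_zero_of_connected hG
  ext h j
  have e1 : ∑ h, (matrixP G E * matrixQ G E) h j • E h = (Fintype.card X : ℂ) • E j := by
    conv_rhs => rw [idempotent_eq_sum hG hE j, smul_inv_smul₀ h0]
    simp_rw [distFamily_eq_sum hE, Finset.smul_sum, Matrix.mul_apply, Finset.sum_smul, smul_smul]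
    rw [Finset.sum_comm]
    exact Finset.sum_congr rfl fun _ _ => Finset.sum_congr rfl fun _ _ => by rw [mul_comm]
  have e2 : ∑ h, ((Fintype.card X : ℂ) • (1 : Matrix _ _ ℂ)) h j • E h
      = (Fintype.card X : ℂ) • E j := by
    simp [Matrix.one_apply, ite_smul]
  exact congrFun ((coord_eq hE.linearIndependent e1).symm.trans
    (coord_eq hE.linearIndependent e2)) h

theorem isCharacterPair (hG : G.Connected) (hE : IsPrimitiveIdempotents G E) :
    IsCharacterPair (Fintype.card X : ℂ) (matrixP G E) (matrixQ G E) := by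
  have h0 := card_ne_zero_of_connected hG
  have hmul := matrixP_mul_matrixQ hG hE
  have hmul' : matrixQ G E * matrixP G E = (Fintype.card X : ℂ) • 1 := by
    have : matrixP G E * ((Fintype.card X : ℂ)⁻¹ • matrixQ G E) = 1 := by
      rw [Matrix.mul_smul, hmul, inv_smul_smul₀ h0]
    rw [mul_eq_one_comm, Matrix.smul_mul, inv_smul_eq_iff₀ h0] at this
    exact this
  have hbal : ∀ i j, matrixQ G E 0 i * matrixP G E i j = matrixP G E 0 j * matrixQ G E j i := by
    intro i j
    obtain ⟨y⟩ := hG.nonempty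
    -- Compare diagonal entries in $A_jE_i=P_{ij}E_i$: on the left, each of the $P_{0j}$ vertices at
    -- distance $j$ from `y` contributes $N^{-1}Q_{ji}$.
    have h := congrFun (congrFun (distFamily_mul_idempotent hE i j) y) y
    have hy : distIndex hG y y = 0 := Fin.ext (SimpleGraph.dist_self)
    rw [Matrix.smul_apply, idempotent_apply hG hE, hy, Matrix.mul_apply, smul_eq_mul] at h
    have h2 : ∀ z, distFamily G j y z * E i z y
        = distFamily G j y z * ((Fintype.card X : ℂ)⁻¹ * matrixQ G E j i) := fun z => by
      rw [idempotent_apply hG hE, distFamily_apply hG, distIndex_comm hG z y]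
      split_ifs with hz
      · rw [hz]
      · simp
    simp_rw [h2] at h
    rw [← Finset.sum_mul, sum_distFamily_apply hG hE] at h
    field_simp at h
    linear_combination -h
  have hleft : ∀ j, matrixP G E 0 j ≠ 0 := by
    intro j
    obtain ⟨y, z, hyz⟩ := exists_distIndex_eq hG j
    rw [← sum_distFamily_apply hG hE j y]
    simp only [distFamily_apply hG, Finset.sum_boole]
    exact Nat.cast_ne_zero.2 (Finset.card_ne_zero.2 ⟨z, by simp [hyz]⟩)
  refine ⟨h0, hmul, hmul', fun i => ?_, fun i => ?_, hbal, hleft, fun i hi => ?_⟩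
  · have : ∑ i, (1 : Fin (G.diam + 1) → ℂ) i • E i = distFamily G 0 := by
      simp [distFamily_zero hG, hE.sum]
    exact congrFun (coord_eq hE.linearIndependent this) i
  · have : ∑ i, (1 : Fin (G.diam + 1) → ℂ) i • distFamily G i = (Fintype.card X : ℂ) • E 0 := by
      rw [hE.zero, smul_inv_smul₀ h0]
      ext y z
      rw [sum_smul_distFamily_apply hG]
      rfl
    exact congrFun (coord_eq (distFamily_linearIndependent hG) this) i
  -- If $Q_{0i}=0$, `hbal` makes the whole column $i$ of $Q$ vanish, against $PQ=NI$.
  · have hz : ∀ j, matrixQ G E j i = 0 := fun j => by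
      have := hbal i j
      rw [hi, zero_mul, eq_comm, mul_eq_zero] at this
      exact this.resolve_left (hleft j)
    have := congrFun (congrFun hmul i) i
    simp [Matrix.mul_apply, hz, eq_comm, h0] at this

theorem distFamily_mul_distFamily (hG : G.Connected) (hE : IsPrimitiveIdempotents G E)
    (i j : Fin (G.diam + 1)) :
    distFamily G i * distFamily G j =
      ∑ h, structureConst (Fintype.card X : ℂ) (matrixP G E) (matrixQ G E) h i j •
        distFamily G h := by
  have h0 := card_ne_zero_of_connected hG
  conv_lhs => rw [distFamily_eq_sum hE j, Finset.mul_sum]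
  simp_rw [Matrix.mul_smul, distFamily_mul_idempotent hE, structureConst]
  conv_lhs => enter [2, t]; rw [idempotent_eq_sum hG hE t]
  simp_rw [Finset.smul_sum, Finset.mul_sum, Finset.sum_smul, smul_smul]
  rw [Finset.sum_comm]
  exact Finset.sum_congr rfl fun _ _ => Finset.sum_congr rfl fun _ _ => by congr 1; ring

/-- The $A_t$ are orthogonal idempotents for the entrywise product, so $E_i\circ E_j$ is computed as
$A_iA_j$ is, with the two bases interchanged. -/
theorem krein_eq_structureConst (hG : G.Connected) (hE : IsPrimitiveIdempotents G E)
    (h i j : Fin (G.diam + 1)) :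
    krein G E h i j = structureConst (Fintype.card X : ℂ) (matrixQ G E) (matrixP G E) h i j := by
  have h0 := card_ne_zero_of_connected hG
  have key : ∑ h, structureConst (Fintype.card X : ℂ) (matrixQ G E) (matrixP G E) h i j • E h
      = (Fintype.card X : ℂ) • (E i).hadamard (E j) := by
    have : (Fintype.card X : ℂ) • (E i).hadamard (E j) = (Fintype.card X : ℂ)⁻¹ •
        ∑ t, (matrixQ G E t i * matrixQ G E t j) • distFamily G t := by
      ext y z
      rw [Matrix.smul_apply, Matrix.smul_apply, Matrix.hadamard_apply,
        sum_smul_distFamily_apply hG fun t => matrixQ G E t i * matrixQ G E t j,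
        idempotent_apply hG hE, idempotent_apply hG hE]
      simp only [smul_eq_mul]
      field_simp
    rw [this]
    simp_rw [distFamily_eq_sum hE, structureConst, Finset.smul_sum, Finset.mul_sum,
      Finset.sum_smul, smul_smul]
    rw [Finset.sum_comm]
    exact Finset.sum_congr rfl fun _ _ => Finset.sum_congr rfl fun _ _ => by congr 1; ring
  exact congrFun (coord_eq hE.linearIndependent key) h

theorem structureConst_eq_card (hG : G.Connected) (hE : IsPrimitiveIdempotents G E)
    (i j : Fin (G.diam + 1)) (y z : X) :
    structureConst (Fintype.card X : ℂ) (matrixP G E) (matrixQ G E) (distIndex hG y z) i j =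
      (Finset.univ.filter fun w => distIndex hG y w = i ∧ distIndex hG w z = j).card := by
  have h := congrFun (congrFun (distFamily_mul_distFamily hG hE i j) y) z
  rw [sum_smul_distFamily_apply hG fun h =>
    structureConst (Fintype.card X : ℂ) (matrixP G E) (matrixQ G E) h i j] at h
  rw [← h, Matrix.mul_apply]
  simp only [distFamily_apply hG, ← ite_and, mul_ite, mul_one, mul_zero, Finset.sum_boole]
  congr 2
  ext w
  simp only [Finset.mem_filter]
  tauto

/-- These constants count vertices `w` with prescribed distances to `y` and `z`. The triangle
inequality excludes any such `w`; in the case of equality a geodesic supplies one. -/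
theorem isTriangular_intersection (hG : G.Connected) (hE : IsPrimitiveIdempotents G E) :
    IsTriangular (structureConst (Fintype.card X : ℂ) (matrixP G E) (matrixQ G E)) := by
  intro h i j
  constructor
  · intro hlt
    obtain ⟨y, z, rfl⟩ := exists_distIndex_eq hG h
    rw [structureConst_eq_card hG hE, Nat.cast_eq_zero, Finset.card_eq_zero,
      Finset.filter_eq_empty_iff]
    rintro w - ⟨rfl, rfl⟩
    simp only [distIndex] at hlt
    have h1 := hG.dist_triangle (u := y) (v := w) (w := z)
    have h2 := hG.dist_triangle (u := y) (v := z) (w := w)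
    have h3 := hG.dist_triangle (u := w) (v := y) (w := z)
    rw [G.dist_comm (u := z) (v := w)] at h2
    rw [G.dist_comm (u := w) (v := y)] at h3
    omega
  · intro heq
    obtain ⟨y, z, w, rfl, rfl, rfl⟩ : ∃ y z w, distIndex hG y z = h ∧ distIndex hG y w = i ∧
        distIndex hG w z = j := by
      rcases heq with e | e | e
      · exact exists_distIndex_between hG e
      · obtain ⟨y, z, w, h1, h2, h3⟩ := exists_distIndex_between hG e
        exact ⟨y, w, z, h2, h1, (distIndex_comm hG _ _).trans h3⟩
      · obtain ⟨y, z, w, h1, h2, h3⟩ := exists_distIndex_between hG e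
        exact ⟨w, y, z, (distIndex_comm hG _ _).trans h2, h3, (distIndex_comm hG _ _).trans h1⟩
    rw [structureConst_eq_card hG hE, Nat.cast_ne_zero]
    exact Finset.card_ne_zero.2 ⟨w, by simp⟩

theorem isQPolynomial_iff (hG : G.Connected) (hE : IsPrimitiveIdempotents G E) :
    IsQPolynomial G E ↔
      IsTriangular (structureConst (Fintype.card X : ℂ) (matrixQ G E) (matrixP G E)) := by
  simp only [IsQPolynomial, IsTriangular, krein_eq_structureConst hG hE]

theorem isFormallySelfDual_iff (hG : G.Connected) (hD : 1 ≤ G.diam)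
    (hE : IsPrimitiveIdempotents G E) :
    IsFormallySelfDual G E ↔
      IsQPolynomial G E ∧ ∀ i, eigenvalueSeq G E i = dualEigenvalueSeq G E i := by
  have hp := isTriangular_intersection hG hE
  rw [isQPolynomial_iff hG hE]
  constructor
  · intro h
    have h : matrixP G E = matrixQ G E := h
    refine ⟨?_, fun i => by rw [eigenvalueSeq, dualEigenvalueSeq, h]⟩
    rw [h] at hp ⊢
    exact hp
  · rintro ⟨hq, hθ⟩
    exact (isCharacterPair hG hE).eq_of_isTriangular hD hp hq hθ

end Eigenmatrices

end LeonardDRG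

namespace LeonardDRG

/-! ### Leonard systems from a pair of bases -/

section Bases

variable {F V : Type*} [Field F] [AddCommGroup V] [Module F V] {d : ℕ}

theorem apply_eq_repr_smul {ι : Type*} [Fintype ι] [DecidableEq ι] (b : Module.Basis ι F V)
    {E : ι → Module.End F V} (hE : ∀ i j, E i (b j) = if i = j then b j else 0) (i : ι) (v : V) :
    E i v = b.repr v i • b i := by
  conv_lhs => rw [← b.sum_repr v]
  simp [-Module.Basis.sum_repr, hE]

theorem repr_apply_of_diag {ι : Type*} [Fintype ι] (b : Module.Basis ι F V) {A : Module.End F V}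
    {θ : ι → F} (hA : ∀ i, A (b i) = θ i • b i) (v : V) (i : ι) :
    b.repr (A v) i = θ i * b.repr v i := by
  classical
  conv_lhs => rw [← b.sum_repr v]
  simp [-Module.Basis.sum_repr, hA, Finsupp.single_apply, mul_comm]

theorem mem_eigenspace_iff_of_diag {ι : Type*} [Fintype ι] (b : Module.Basis ι F V)
    {A : Module.End F V} {θ : ι → F} (hθ : Function.Injective θ) (hA : ∀ i, A (b i) = θ i • b i)
    (i : ι) (v : V) : v ∈ A.eigenspace (θ i) ↔ v = b.repr v i • b i := by
  classical
  rw [Module.End.mem_eigenspace_iff]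
  constructor
  · intro h
    have hz : ∀ j, j ≠ i → b.repr v j = 0 := fun j hj => by
      have h1 := repr_apply_of_diag b hA v j
      rw [h, map_smul, Finsupp.smul_apply, smul_eq_mul, eq_comm, ← sub_eq_zero, ← sub_mul] at h1
      exact (mul_eq_zero.1 h1).resolve_left (sub_ne_zero.2 fun e => hj (hθ e))
    conv_lhs => rw [← b.sum_repr v]
    exact Finset.sum_eq_single_of_mem i (Finset.mem_univ _) fun j _ hj => by
      rw [hz j hj, zero_smul]
  · intro h
    rw [h, map_smul, hA, smul_comm]

theorem isPrimitiveIdempotentOrdering_of_basis (b : Module.Basis (Fin (d + 1)) F V)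
    {A : Module.End F V} {E : Fin (d + 1) → Module.End F V} {θ : Fin (d + 1) → F}
    (hθ : Function.Injective θ) (hA : ∀ i, A (b i) = θ i • b i)
    (hE : ∀ i j, E i (b j) = if i = j then b j else 0) : IsPrimitiveIdempotentOrdering A E := by
  have hmem := mem_eigenspace_iff_of_diag b hθ hA
  have hb : ∀ i, b i ∈ A.eigenspace (θ i) := fun i => Module.End.mem_eigenspace_iff.2 (hA i)
  have hval : ∀ μ : F, A.HasEigenvalue μ ↔ ∃ i, θ i = μ := by
    intro μ
    constructor
    · intro h
      obtain ⟨v, hv⟩ := h.exists_hasEigenvector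
      by_contra! hne
      refine hv.2 (b.ext_elem fun i => ?_)
      have h1 := repr_apply_of_diag b hA v i
      rw [hv.apply_eq_smul, map_smul, Finsupp.smul_apply, smul_eq_mul, eq_comm, ← sub_eq_zero,
        ← sub_mul] at h1
      simpa using (mul_eq_zero.1 h1).resolve_left (sub_ne_zero.2 (hne i))
    · rintro ⟨i, rfl⟩
      exact Module.End.hasEigenvalue_of_hasEigenvector ⟨hb i, b.ne_zero i⟩
  refine ⟨⟨?_, ?_⟩, θ, hθ, hval, ?_, ?_⟩
  · rw [eq_top_iff, ← b.span_eq, Submodule.span_le]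
    rintro _ ⟨i, rfl⟩
    exact Submodule.mem_iSup_of_mem (θ i) (hb i)
  · intro μ hμ
    obtain ⟨i, rfl⟩ := (hval μ).1 hμ
    refine finrank_eq_one_iff'.2 ⟨⟨b i, hb i⟩, fun h => b.ne_zero i (congrArg Subtype.val h), ?_⟩
    rintro ⟨v, hv⟩
    exact ⟨b.repr v i, Subtype.ext ((hmem i v).1 hv).symm⟩
  · intro i v hv
    rw [apply_eq_repr_smul b hE, ← (hmem i v).1 hv]
  · intro i j hji v hv
    rw [(hmem j v).1 hv, map_smul, hE, if_neg hji.symm, smul_zero]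

/-- With middle index 1, the triangle condition is exactly irreducible tridiagonality. -/
theorem isTridiagonalDiagonal_of_basis {p : Fin (d + 1) → Fin (d + 1) → Fin (d + 1) → ℂ}
    [Module ℂ V] (hd : 1 ≤ d) (hp : IsTriangular p) (b : Module.Basis (Fin (d + 1)) ℂ V)
    {A B : Module.End ℂ V} {θ : Fin (d + 1) → ℂ}
    (hA : ∀ j, A (b j) = ∑ h, p h 1 j • b h) (hB : ∀ i, B (b i) = θ i • b i) :
    IsTridiagonalDiagonal b A B := by
  have v1 := val_one hd
  have hM : ∀ i j, LinearMap.toMatrix b b A i j = p i 1 j := fun i j => by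
    simp [LinearMap.toMatrix_apply, hA, Finsupp.single_apply]
  refine ⟨⟨fun i j hij => ?_, fun i j hij => ?_, fun i j hij => ?_⟩, fun i j hij => ?_⟩
  · by_contra hne
    refine hij ?_
    rw [hM]
    exact (hp i 1 j).1 (by omega)
  · rw [hM]
    exact (hp i 1 j).2 (by omega)
  · rw [hM]
    exact (hp i 1 j).2 (by omega)
  · simp [LinearMap.toMatrix_apply, hB, hij.symm]

theorem conjAlgEquiv_eq_of_basis {ι : Type*} (c : Module.Basis ι F V) (S : V ≃ₗ[F] V)
    {f g : Module.End F V} (h : ∀ i, S (f (c i)) = g (S (c i))) : S.conjAlgEquiv F f = g := by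
  refine (c.map S).ext fun i => ?_
  simp [LinearEquiv.conjAlgEquiv_apply, h]

/-- A sequence whose two eigenbases are exchanged, up to the scalar `N`, by a linear map is a
self-dual Leonard system. -/
theorem EndSeq.isSelfDualLeonardSystem_of_bases [Module ℂ V] (hd : 1 ≤ d) (Φ : EndSeq ℂ V d)
    (b b' : Module.Basis (Fin (d + 1)) ℂ V) {θ : Fin (d + 1) → ℂ} (hθ : Function.Injective θ)
    {p : Fin (d + 1) → Fin (d + 1) → Fin (d + 1) → ℂ} (hp : IsTriangular p)
    {P : Matrix (Fin (d + 1)) (Fin (d + 1)) ℂ} {N : ℂ}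
    (hA : ∀ i, Φ.A (b i) = θ i • b i) (hE : ∀ i j, Φ.E i (b j) = if i = j then b j else 0)
    (hA' : ∀ j, Φ.A (b' j) = ∑ h, p h 1 j • b' h)
    (hAstar : ∀ i, Φ.Astar (b' i) = θ i • b' i)
    (hEstar : ∀ i j, Φ.Estar i (b' j) = if i = j then b' j else 0)
    (hAstar' : ∀ j, Φ.Astar (b j) = ∑ h, p h 1 j • b h)
    (hb' : ∀ j, b' j = ∑ i, P i j • b i) (hb : ∀ j, N • b j = ∑ i, P i j • b' i) :
    Φ.IsSelfDualLeonardSystem := by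
  have t1 := isTridiagonalDiagonal_of_basis hd hp b' hA' hAstar
  have t2 := isTridiagonalDiagonal_of_basis hd hp b hAstar' hA
  have hrange : ∀ i, b i ∈ LinearMap.range (Φ.E i) := fun i => ⟨b i, by simp [hE]⟩
  have hrange' : ∀ i, b' i ∈ LinearMap.range (Φ.Estar i) := fun i => ⟨b' i, by simp [hEstar]⟩
  refine ⟨⟨⟨⟨b', t1⟩, b, t2⟩,
    ⟨isPrimitiveIdempotentOrdering_of_basis b hθ hA hE, b, hrange, t2⟩,
    ⟨isPrimitiveIdempotentOrdering_of_basis b' hθ hAstar hEstar, b', hrange', t1⟩⟩, ?_⟩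
  let S : V ≃ₗ[ℂ] V := b.equiv b' (Equiv.refl _)
  have hS : ∀ i, S (b i) = b' i := fun i => by simp [S]
  -- Both transitions use the same `P`, so `S` squares to `N` and conjugation by `S` exchanges the
  -- data in both directions.
  have hS' : ∀ i, S (b' i) = N • b i := fun i => by
    rw [hb', hb, map_sum]
    simp [hS]
  refine ⟨S.conjAlgEquiv ℂ, ?_, ?_, fun i => ?_, fun i => ?_⟩
  · exact conjAlgEquiv_eq_of_basis b S fun i => by simp [EndSeq.dual, hA, hS, hAstar]
  · exact conjAlgEquiv_eq_of_basis b' S fun i => by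
      simp [EndSeq.dual, hA, hS', hAstar, smul_comm N]
  · exact conjAlgEquiv_eq_of_basis b S fun j => by
      simp only [EndSeq.dual, hE, hS, hEstar]
      split_ifs <;> simp [hS]
  · exact conjAlgEquiv_eq_of_basis b' S fun j => by
      simp only [EndSeq.dual, hEstar, hS', hE, map_smul]
      split_ifs <;> simp [hS']

/-- If an automorphism of `End V` exchanges the coordinate idempotents of two bases, and both
transition matrices have a first column of ones, then the transition matrices agree. -/
theorem transition_eq_of_algEquiv [Module ℂ V] (b b' : Module.Basis (Fin (d + 1)) ℂ V)
    {E E' : Fin (d + 1) → Module.End ℂ V}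
    (hE : ∀ i j, E i (b j) = if i = j then b j else 0)
    (hE' : ∀ i j, E' i (b' j) = if i = j then b' j else 0)
    {P Q : Matrix (Fin (d + 1)) (Fin (d + 1)) ℂ} {N : ℂ} (hN : N ≠ 0)
    (hb' : ∀ j, b' j = ∑ i, P i j • b i) (hb : ∀ j, N • b j = ∑ i, Q i j • b' i)
    (hP : ∀ i, P i 0 = 1) (hQ : ∀ i, Q i 0 = 1)
    (σ : Module.End ℂ V ≃ₐ[ℂ] Module.End ℂ V) (hσ : ∀ i, σ (E i) = E' i)
    (hσ' : ∀ i, σ (E' i) = E i) : P = Q := by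
  -- Every automorphism of `End V` is inner. As `S` intertwines the rank-one idempotents, it maps
  -- each basis vector to a multiple of the corresponding vector of the other basis.
  obtain ⟨S, rfl⟩ := σ.eq_linearEquivConjAlgEquiv
  have comm : ∀ i v, S (E i v) = E' i (S v) := fun i v => by
    rw [← hσ]; simp [LinearEquiv.conjAlgEquiv_apply]
  have comm' : ∀ i v, S (E' i v) = E i (S v) := fun i v => by
    rw [← hσ' i]; simp [LinearEquiv.conjAlgEquiv_apply]
  obtain ⟨α, hα⟩ : ∃ α : Fin (d + 1) → ℂ, ∀ i, S (b i) = α i • b' i :=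
    ⟨fun i => b'.repr (S (b i)) i, fun i => by
      rw [← apply_eq_repr_smul b' hE', ← comm, hE, if_pos rfl]⟩
  obtain ⟨β, hβ⟩ : ∃ β : Fin (d + 1) → ℂ, ∀ i, S (b' i) = β i • b i :=
    ⟨fun i => b.repr (S (b' i)) i, fun i => by
      rw [← apply_eq_repr_smul b hE, ← comm', hE', if_pos rfl]⟩
  have e1 : ∀ i j, N * (α i * P i j) = β j * Q i j := by
    intro i j
    have h := congrArg (fun v => N • S v) (hb' j)
    simp only [map_sum, map_smul, hα, hβ, smul_comm N (β j), hb, Finset.smul_sum, smul_smul] at h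
    have := congrArg (fun v => b'.repr v i) h
    simp [Finsupp.single_apply] at this
    linear_combination -this
  have e2 : ∀ i j, N * (α j * P i j) = β i * Q i j := by
    intro i j
    have h : N • α j • b' j = ∑ i, Q i j • β i • b i := by
      rw [← hα, ← map_smul, hb, map_sum]
      simp only [map_smul, hβ]
    simp only [hb', Finset.smul_sum, smul_smul] at h
    have := congrArg (fun v => b.repr v i) h
    simp [Finsupp.single_apply] at this
    linear_combination this
  have hα0 : α 0 ≠ 0 := fun h => b.ne_zero 0 (S.map_eq_zero_iff.1 (by rw [hα, h, zero_smul]))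
  ext i j
  -- Column 0 of `e2` gives $\beta_i=N\alpha_0$ for all $i$, and column 0 of `e1` gives
  -- $N\alpha_i=\beta_0$. Both scalar families are constant, so `e1` becomes $P_{ij}=Q_{ij}$.
  have h1 := e2 i 0
  have h2 := e1 i 0
  have h3 := e2 0 0
  rw [hP, hQ] at h1 h2 h3
  have h4 := e2 j 0
  rw [hP, hQ] at h4
  have h5 : N * α 0 ≠ 0 := mul_ne_zero hN hα0
  refine mul_left_cancel₀ h5 ?_
  linear_combination e1 i j + Q i j * (-h4) + P i j * (h3 - h2)

end Bases

end LeonardDRG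

namespace LeonardDRG

/-! ### The primary module -/

section PrimaryModule

theorem mulVec_col {X : Type*} [Fintype X] (B C : Matrix X X ℂ) (x : X) : B *ᵥ C.col x = (B * C).col x := by
  ext y
  rfl

theorem exists_actsAs {X : Type*} [Fintype X] {U : Submodule ℂ (X → ℂ)} {B : Matrix X X ℂ}
    (h : ∀ u ∈ U, B *ᵥ u ∈ U) : ∃ f : Module.End ℂ U, ActsAs B f :=
  ⟨B.mulVecLin.restrict h, fun _ => rfl⟩

variable {X : Type*} [Fintype X] [DecidableEq X] {G : SimpleGraph X}
  {E : Fin (G.diam + 1) → Matrix X X ℂ}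

/-- The map `B ↦ B x̂` from the Bose-Mesner algebra onto the primary module. -/
noncomputable def evalPrimary (G : SimpleGraph X) (x : X) :
    boseMesner G →ₗ[ℂ] primaryModule G x :=
  ((Matrix.mulVecBilin ℂ ℂ).flip (Pi.single x 1 : X → ℂ)).submoduleMap (boseMesner G)

theorem coe_evalPrimary (x : X) (B : boseMesner G) (y : X) :
    (evalPrimary G x B : X → ℂ) y = (B : Matrix X X ℂ) y x := by
  change (((Matrix.mulVecBilin ℂ ℂ).flip (Pi.single x 1 : X → ℂ)) (B : Matrix X X ℂ)) y = _
  simp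

/-- The valency $P_{0i}$ is nonzero and does not depend on the base vertex, so every distance occurs
from `x` itself. -/
theorem exists_distIndex_eq_left (hG : G.Connected) (hE : IsPrimitiveIdempotents G E) (x : X)
    (i : Fin (G.diam + 1)) : ∃ y, distIndex hG x y = i := by
  have h := (isCharacterPair hG hE).left_ne i
  rw [← sum_distFamily_apply hG hE i x] at h
  obtain ⟨y, -, hy⟩ := Finset.exists_ne_zero_of_sum_ne_zero h
  rw [distFamily_apply hG] at hy
  exact ⟨y, by_contra fun hne => hy (if_neg hne)⟩

/-- Entries of a matrix in the algebra depend only on distance, and all distances occur from `x`, so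
column `x` determines the matrix. -/
theorem evalPrimary_bijective (hG : G.Connected) (hE : IsPrimitiveIdempotents G E) (x : X) :
    Function.Bijective (evalPrimary G x) := by
  refine ⟨(injective_iff_map_eq_zero _).2 fun B hB => ?_, LinearMap.submoduleMap_surjective _ _⟩
  obtain ⟨f, hf⟩ := (mem_boseMesner hG B).1 B.2
  refine Subtype.ext (Matrix.ext fun y z => ?_)
  obtain ⟨w, hw⟩ := exists_distIndex_eq_left hG hE x (distIndex hG y z)
  have hw : G.dist x w = G.dist y z := congrArg Fin.val hw
  have h := congrFun (congrArg Subtype.val hB) w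
  rw [coe_evalPrimary, hf, G.dist_comm, hw] at h
  rw [hf, h]
  rfl

/-- The Bose-Mesner algebra is isomorphic to the primary module. -/
noncomputable def primaryEquiv (hG : G.Connected) (hE : IsPrimitiveIdempotents G E) (x : X) :
    boseMesner G ≃ₗ[ℂ] primaryModule G x :=
  LinearEquiv.ofBijective _ (evalPrimary_bijective hG hE x)

/-- The basis of the primary module obtained from a basis of the Bose-Mesner algebra. -/
noncomputable def primaryBasis (hG : G.Connected) (hE : IsPrimitiveIdempotents G E) (x : X)
    {B : Fin (G.diam + 1) → Matrix X X ℂ} (hB : LinearIndependent ℂ B)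
    (hspan : Submodule.span ℂ (Set.range B) = boseMesner G) :
    Module.Basis (Fin (G.diam + 1)) ℂ (primaryModule G x) :=
  (Module.Basis.span hB).map ((LinearEquiv.ofEq _ _ hspan).trans (primaryEquiv hG hE x))

theorem primaryBasis_apply (hG : G.Connected) (hE : IsPrimitiveIdempotents G E) (x : X)
    {B : Fin (G.diam + 1) → Matrix X X ℂ} (hB : LinearIndependent ℂ B)
    (hspan : Submodule.span ℂ (Set.range B) = boseMesner G) (i : Fin (G.diam + 1)) (y : X) :
    (primaryBasis hG hE x hB hspan i : X → ℂ) y = B i y x := by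
  rw [primaryBasis, Module.Basis.map_apply, LinearEquiv.trans_apply]
  refine (coe_evalPrimary x _ y).trans ?_
  rw [LinearEquiv.coe_ofEq_apply, Module.Basis.span_apply]

/-- The basis `A_i x̂` of the primary module. -/
noncomputable def sphereBasis (hG : G.Connected) (hE : IsPrimitiveIdempotents G E) (x : X) :
    Module.Basis (Fin (G.diam + 1)) ℂ (primaryModule G x) :=
  primaryBasis hG hE x (distFamily_linearIndependent hG) rfl

/-- The basis `E_i x̂` of the primary module. -/
noncomputable def idempotentBasis (hG : G.Connected) (hE : IsPrimitiveIdempotents G E) (x : X) :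
    Module.Basis (Fin (G.diam + 1)) ℂ (primaryModule G x) :=
  primaryBasis hG hE x hE.linearIndependent hE.span_eq

theorem sphereBasis_apply (hG : G.Connected) (hE : IsPrimitiveIdempotents G E) (x : X)
    (i : Fin (G.diam + 1)) (y : X) :
    (sphereBasis hG hE x i : X → ℂ) y = distFamily G i y x :=
  primaryBasis_apply ..

theorem idempotentBasis_apply (hG : G.Connected) (hE : IsPrimitiveIdempotents G E) (x : X)
    (i : Fin (G.diam + 1)) (y : X) :
    (idempotentBasis hG hE x i : X → ℂ) y = E i y x :=
  primaryBasis_apply ..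

theorem coe_idempotentBasis (hG : G.Connected) (hE : IsPrimitiveIdempotents G E) (x : X)
    (i : Fin (G.diam + 1)) : (idempotentBasis hG hE x i : X → ℂ) = (E i).col x :=
  funext (idempotentBasis_apply hG hE x i)

theorem coe_sphereBasis (hG : G.Connected) (hE : IsPrimitiveIdempotents G E) (x : X)
    (i : Fin (G.diam + 1)) : (sphereBasis hG hE x i : X → ℂ) = (distFamily G i).col x :=
  funext (sphereBasis_apply hG hE x i)

theorem sphereBasis_eq_sum (hG : G.Connected) (hE : IsPrimitiveIdempotents G E) (x : X)
    (j : Fin (G.diam + 1)) :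
    sphereBasis hG hE x j = ∑ i, matrixP G E i j • idempotentBasis hG hE x i := by
  ext y
  have h := congrFun (congrFun (distFamily_eq_sum hE j) y) x
  rw [Matrix.sum_apply] at h
  simp [sphereBasis_apply, idempotentBasis_apply, h]

theorem smul_idempotentBasis_eq_sum (hG : G.Connected) (hE : IsPrimitiveIdempotents G E) (x : X)
    (j : Fin (G.diam + 1)) :
    (Fintype.card X : ℂ) • idempotentBasis hG hE x j =
      ∑ i, matrixQ G E i j • sphereBasis hG hE x i := by
  have h0 := card_ne_zero_of_connected hG
  ext y
  have h := congrFun (congrFun (idempotent_eq_sum hG hE j) y) x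
  rw [Matrix.smul_apply, Matrix.sum_apply] at h
  simp [sphereBasis_apply, idempotentBasis_apply, h, h0]

/-! ### Action of the generators on the two bases of the primary module. -/

section Actions

variable {hG : G.Connected} {hE : IsPrimitiveIdempotents G E} {x : X}
  {f : Module.End ℂ (primaryModule G x)}

theorem ActsAs.idempotent_apply {i : Fin (G.diam + 1)} (h : ActsAs (E i) f)
    (j : Fin (G.diam + 1)) :
    f (idempotentBasis hG hE x j) = if i = j then idempotentBasis hG hE x j else 0 := by
  refine Subtype.ext ?_
  rw [← h, coe_idempotentBasis, mulVec_col, hE.mul]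
  split_ifs with hij
  · rw [hij, coe_idempotentBasis]
  · rfl

theorem ActsAs.dualIdempotent_apply {i : Fin (G.diam + 1)} (h : ActsAs (dualIdempotent G x i) f)
    (j : Fin (G.diam + 1)) :
    f (sphereBasis hG hE x j) = if i = j then sphereBasis hG hE x j else 0 := by
  refine Subtype.ext (funext fun y => ?_)
  rw [← h, dualIdempotent, Matrix.mulVec_diagonal, sphereBasis_apply]
  have : (G.dist x y = i) ↔ distIndex hG y x = i := by
    rw [distIndex_comm, Fin.ext_iff]; rfl
  simp only [this]
  split_ifs with h1 h2 h2
  · rw [sphereBasis_apply, one_mul]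
  · rw [distFamily_apply hG, if_neg fun h3 => h2 (h1.symm.trans h3)]
    simp
  · rw [sphereBasis_apply, distFamily_apply hG, if_neg fun h3 => h1 (h3.trans h2.symm)]
    simp
  · simp

theorem ActsAs.distFamily_apply_idempotentBasis {j : Fin (G.diam + 1)}
    (h : ActsAs (distFamily G j) f) (i : Fin (G.diam + 1)) :
    f (idempotentBasis hG hE x i) = matrixP G E i j • idempotentBasis hG hE x i := by
  refine Subtype.ext ?_
  rw [← h, coe_idempotentBasis, mulVec_col, distFamily_mul_idempotent hE, Submodule.coe_smul,
    coe_idempotentBasis]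
  rfl

theorem ActsAs.distFamily_apply_sphereBasis {i : Fin (G.diam + 1)}
    (h : ActsAs (distFamily G i) f) (j : Fin (G.diam + 1)) :
    f (sphereBasis hG hE x j) =
      ∑ h, structureConst (Fintype.card X : ℂ) (matrixP G E) (matrixQ G E) h i j •
        sphereBasis hG hE x h := by
  refine Subtype.ext (funext fun y => ?_)
  rw [← h, coe_sphereBasis, mulVec_col, distFamily_mul_distFamily hG hE]
  simp [sphereBasis_apply, Matrix.sum_apply]

theorem ActsAs.dualDistMatrix_apply_sphereBasis {j : Fin (G.diam + 1)}
    (h : ActsAs (dualDistMatrix (E j) x) f) (i : Fin (G.diam + 1)) :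
    f (sphereBasis hG hE x i) = matrixQ G E i j • sphereBasis hG hE x i := by
  have h0 := card_ne_zero_of_connected hG
  refine Subtype.ext (funext fun y => ?_)
  rw [← h, dualDistMatrix, Matrix.mulVec_diagonal, sphereBasis_apply, Submodule.coe_smul,
    Pi.smul_apply, sphereBasis_apply, LeonardDRG.idempotent_apply hG hE, mul_inv_cancel_left₀ h0,
    distFamily_apply hG, distIndex_comm hG x y, smul_eq_mul]
  split_ifs with hi
  · rw [hi]
  · simp

/-- The vector $A^*_iE_j\hat x$ is column $x$ of $N\,E_i\circ E_j$, so its coefficients are Krein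
parameters. -/
theorem ActsAs.dualDistMatrix_apply_idempotentBasis {i : Fin (G.diam + 1)}
    (h : ActsAs (dualDistMatrix (E i) x) f) (j : Fin (G.diam + 1)) :
    f (idempotentBasis hG hE x j) =
      ∑ h, structureConst (Fintype.card X : ℂ) (matrixQ G E) (matrixP G E) h i j •
        idempotentBasis hG hE x h := by
  have h0 := card_ne_zero_of_connected hG
  refine Subtype.ext (funext fun y => ?_)
  have hsymm : E i x y = E i y x := by
    rw [LeonardDRG.idempotent_apply hG hE, LeonardDRG.idempotent_apply hG hE, distIndex_comm]
  have hh := congrFun (congrFun (hadamard_eq_sum hG hE i j) y) x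
  rw [Matrix.smul_apply, Matrix.sum_apply, Matrix.hadamard_apply] at hh
  rw [← h, dualDistMatrix, Matrix.mulVec_diagonal, idempotentBasis_apply, hsymm, mul_assoc, hh]
  simp [idempotentBasis_apply, krein_eq_structureConst hG hE, h0]

end Actions

theorem mulVec_mem_primaryModule (hG : IsDistanceRegular G) (x : X) {B : Matrix X X ℂ}
    (hB : B ∈ boseMesner G) {u : X → ℂ} (hu : u ∈ primaryModule G x) :
    B *ᵥ u ∈ primaryModule G x :=
  primaryModule_isTModule hG x B (Algebra.subset_adjoin (.inl hB)) u hu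

theorem diagonal_mulVec_mem_primaryModule (hG : G.Connected) (x : X) (g : ℕ → ℂ) {u : X → ℂ}
    (hu : u ∈ primaryModule G x) :
    (Matrix.diagonal fun y => g (G.dist x y)) *ᵥ u ∈ primaryModule G x := by
  obtain ⟨f, hf⟩ := (mem_primaryModule hG x u).1 hu
  exact (mem_primaryModule hG x _).2 ⟨fun n => g n * f n, fun y => by
    rw [Matrix.mulVec_diagonal, hf]⟩

/-- The generators of the Terwilliger algebra act on the primary module. -/
theorem exists_endSeq_actsAs (hG : IsDistanceRegular G) (hE : IsPrimitiveIdempotents G E) (x : X)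
    (j : Fin (G.diam + 1)) :
    ∃ Φ : EndSeq ℂ (primaryModule G x) G.diam,
      ActsAs (distFamily G j) Φ.A ∧ (∀ i, ActsAs (E i) (Φ.E i)) ∧
      ActsAs (dualDistMatrix (E j) x) Φ.Astar ∧
      ∀ i : Fin (G.diam + 1), ActsAs (dualIdempotent G x i) (Φ.Estar i) := by
  obtain ⟨A, hA⟩ := exists_actsAs fun u hu => mulVec_mem_primaryModule hG x
    (Submodule.subset_span ⟨j, rfl⟩ : distFamily G j ∈ boseMesner G) (u := u) hu
  have hE' := fun i => exists_actsAs fun u hu => mulVec_mem_primaryModule hG x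
    (mem_boseMesner_of_isPrimitiveIdempotents hE i) (u := u) hu
  obtain ⟨g, hg⟩ := (mem_boseMesner hG.1 _).1 (mem_boseMesner_of_isPrimitiveIdempotents hE j)
  obtain ⟨Astar, hAstar⟩ : ∃ f : Module.End ℂ (primaryModule G x),
      ActsAs (dualDistMatrix (E j) x) f := exists_actsAs fun u hu => by
    simp only [dualDistMatrix, hg]
    exact diagonal_mulVec_mem_primaryModule hG.1 x (fun n => (Fintype.card X : ℂ) * g n) hu
  have hEstar' : ∀ i : Fin (G.diam + 1), ∃ f : Module.End ℂ (primaryModule G x),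
      ActsAs (dualIdempotent G x i) f := fun i => exists_actsAs fun u hu =>
    diagonal_mulVec_mem_primaryModule hG.1 x (fun n => if n = i then 1 else 0) hu
  choose E' hE' using hE'
  choose Estar hEstar using hEstar'
  exact ⟨⟨A, E', Astar, Estar⟩, hA, hE', hAstar, hEstar⟩

theorem actsAsSelfDualLeonardSystem_of_isFormallySelfDual (hG : IsDistanceRegular G)
    (hD : 1 ≤ G.diam) (hE : IsPrimitiveIdempotents G E) (x : X) (hPQ : IsFormallySelfDual G E) :
    ActsAsSelfDualLeonardSystem (primaryModule G x) (distFamily G 1) E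
      (dualDistMatrix (E 1) x) fun i : Fin (G.diam + 1) => dualIdempotent G x i := by
  have hPQ : matrixQ G E = matrixP G E := Eq.symm hPQ
  have hp := isTriangular_intersection hG.1 hE
  have hθ := (isCharacterPair hG.1 hE).injective hD hp
  obtain ⟨Φ, hA, hE', hAstar, hEstar⟩ := exists_endSeq_actsAs hG hE x 1
  refine ⟨Φ, hA, hE', hAstar, hEstar, ?_⟩
  refine Φ.isSelfDualLeonardSystem_of_bases hD (idempotentBasis hG.1 hE x)
    (sphereBasis hG.1 hE x) hθ hp hA.distFamily_apply_idempotentBasis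
    (fun i => (hE' i).idempotent_apply) hA.distFamily_apply_sphereBasis ?_
    (fun i => (hEstar i).dualIdempotent_apply) ?_ (sphereBasis_eq_sum hG.1 hE x)
    (N := (Fintype.card X : ℂ)) ?_
  · intro i
    rw [hAstar.dualDistMatrix_apply_sphereBasis, hPQ]
  · intro j
    rw [hAstar.dualDistMatrix_apply_idempotentBasis, hPQ]
  · intro j
    rw [smul_idempotentBasis_eq_sum, hPQ]

/-- On $U$ the $E_i$ and $E^*_i$ are the coordinate idempotents of the two bases, and the
automorphism exchanges them, so `transition_eq_of_algEquiv` applies. -/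
theorem isFormallySelfDual_of_actsAsSelfDualLeonardSystem (hG : G.Connected)
    (hE : IsPrimitiveIdempotents G E) (x : X) {A Astar : Matrix X X ℂ}
    (h : ActsAsSelfDualLeonardSystem (primaryModule G x) A E Astar
      fun i : Fin (G.diam + 1) => dualIdempotent G x i) : IsFormallySelfDual G E := by
  obtain ⟨Φ, -, hE', -, hEstar, -, σ, -, -, hσ, hσ'⟩ := h
  have H := isCharacterPair hG hE
  exact transition_eq_of_algEquiv (idempotentBasis hG hE x) (sphereBasis hG hE x)
    (fun i => (hE' i).idempotent_apply) (fun i => (hEstar i).dualIdempotent_apply) H.ne_zero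
    (sphereBasis_eq_sum hG hE x) (smul_idempotentBasis_eq_sum hG hE x) H.left_zero H.right_zero
    σ hσ hσ'

end PrimaryModule

end LeonardDRG

theorem proposition10p3 {X : Type*} [Fintype X] [DecidableEq X] (G : SimpleGraph X)
    (hG : LeonardDRG.IsDistanceRegular G) (hD : 1 ≤ G.diam)
    (E : Fin (G.diam + 1) → Matrix X X ℂ) (hE : LeonardDRG.IsPrimitiveIdempotents G E) (x : X) :
    List.TFAE [
      LeonardDRG.IsFormallySelfDual G E,
      LeonardDRG.IsQPolynomial G E ∧
        ∀ i, LeonardDRG.eigenvalueSeq G E i = LeonardDRG.dualEigenvalueSeq G E i,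
      LeonardDRG.ActsAsSelfDualLeonardSystem (LeonardDRG.primaryModule G x)
        (LeonardDRG.distMatrix G 1) E
        (LeonardDRG.dualDistMatrix (E 1) x)
        (fun i : Fin (G.diam + 1) => LeonardDRG.dualIdempotent G x i)] := by
  have h1 : LeonardDRG.distMatrix G 1 = LeonardDRG.distFamily G 1 := by
    rw [LeonardDRG.distFamily, LeonardDRG.val_one hD]
  rw [h1]
  tfae_have 1 ↔ 2 := LeonardDRG.isFormallySelfDual_iff hG.1 hD hE
  tfae_have 1 → 3 :=
    LeonardDRG.actsAsSelfDualLeonardSystem_of_isFormallySelfDual hG hD hE x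
  tfae_have 3 → 1 := LeonardDRG.isFormallySelfDual_of_actsAsSelfDualLeonardSystem hG.1 hE x
  tfae_finish
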